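/- Let $n\ge 1$, $q\in(0,1)$ and $a=(a_1,\dots,a_n)\in\mathbb{R}_{>0}^n$. Let $\Lambda_m$ be the set of partitions with at most $m$ nonzero parts (parts beyond the length are $0$), let $|\lambda|$ be the sum of the parts of $\lambda$, and write $\mu\preceq\lambda$ if $\lambda_1\ge\mu_1\ge\lambda_2\ge\mu_2\ge\cdots$. Let $\mathbb{K}^{2n}$ be the set of symplectic Gelfand–Tsetlin patterns $Z=(z^1,\dots,z^{2n})$, i.e. $z^{2l-1},z^{2l}\in\Lambda_l$ for $1\le l\le n$ and $z^1\preceq z^2\preceq\cdots\preceq z^{2n}$; put $z^0=\emptyset$. Let $e_i$ be the $i$-th unit vector. With $(q;q)_m=\prod_{k=1}^m(1-q^k)$ and $\binom{m}{k}_q=\frac{(q;q)_m}{(q;q)_k(q;q)_{m-k}}$, set $$a^Z=\prod_{i=1}^n a_i^{2|z^{2i-1}|-|z^{2i}|-|z^{2i-2}|},$$ $$\kappa_n(Z)=\prod_{k=1}^n\left[\binom{z^{2k}_k}{z^{2k}_k-z^{2k-1}_k}_q\prod_{i=1}^{k-1}\binom{z^{2k-1}_i-z^{2k-1}_{i+1}}{z^{2k-1}_i-z^{2k-2}_i}_q\binom{z^{2k}_i-z^{2k}_{i+1}}{z^{2k}_i-z^{2k-1}_i}_q\right],$$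 and, for $\lambda\in\Lambda_n$ and $Z\in\mathbb{K}^{2n}$, $K_n(\lambda,Z)=a^Z\kappa_n(Z)\mathbf 1_{z^{2n}=\lambda}$. For $\lambda,\mu\in\Lambda_n$ let $L_n(\lambda,\mu)=u^+_i(\lambda)$ if $\mu=\lambda+e_i$, $L_n(\lambda,\mu)=u^-_i(\lambda)$ if $\mu=\lambda-e_i$ (for some $1\le i\le n$), and $L_n(\lambda,\mu)=0$ otherwise, where $u_1^+(\lambda)=1$, $u_i^+(\lambda)=1-q^{\lambda_{i-1}-\lambda_i}$ for $1<i\le n$, $u_i^-(\lambda)=1-q^{\lambda_i-\lambda_{i+1}}$ for $1\le i<n$, and $u_n^-(\lambda)=1-q^{\lambda_n}$. For $x\preceq y$ set $$r_i(y;x)=q^{y_i-x_i}\frac{1-q^{x_{i-1}-y_i}}{1-q^{x_{i-1}-x_i}},\qquad l_i(y;x)=q^{x_i-y_{i+1}}\frac{1-q^{y_{i+1}-x_{i+1}}}{1-q^{x_i-x_{i+1}}},$$ with $x_0=\infty$ (so $r_1(y;x)=q^{y_1-x_1}$). Consider the alphabet $[n,\bar n]=\{1<\bar 1<\cdots<n<\bar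 n\}$, in which the letters $l$ and $\bar l$ have orders $2l-1$ and $2l$, and put $a_{\bar l}=a_l^{-1}$. The $q$-deformed Berele insertion of a letter of order $k_0$ into $Z\in\mathbb{K}^{2n}$ is the following random procedure. The particle $z^{k_0}_1$ attempts a right jump, and levels $1,\dots,k_0-1$ do not change. For $k<2n$, all probabilities being evaluated at the pattern $Z$ before the insertion: (i) if $z^k_i$ attempts a right jump and $k=2i-1$, then with probability $r_i(z^{k+1};z^k)$ it increases by $1$ and $z^{k+1}_i$ attempts a right jump, and with probability $1-r_i(z^{k+1};z^k)$ level $k$ does not change and $z^{k+1}_i$ jumps to the left; (ii) if $z^k_i$ attempts a right jump and $k\ne 2i-1$, then it increases by $1$, and $z^{k+1}_i$ attempts a right jump with probability $r_i(z^{k+1};z^k)$, while $z^{k+1}_{i+1}$ attempts a right jump with probability $1-r_i(z^{k+1};z^k)$; (iii) if $z^k_i$ jumps to the left, then it decreases by $1$, and $z^{k+1}_{i+1}$ jumps to the left with probability $l_i(z^{k+1};z^k)$, while $z^{k+1}_i$ jumps to the left with probability $1-l_i(z^{k+1};z^k)$. At level $2n$ every attempted jump is performed. (Expressions $0/0$ arise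 only for moves of probability zero and play no role.) Let $I_l(Z,\tilde Z)$ be the probability that inserting $l$ into $Z$ produces $\tilde Z\in\mathbb{K}^{2n}$, and let $M_n(Z,\tilde Z)=\sum_{l\in[n,\bar n]}a_l\,I_l(Z,\tilde Z)$. **Theorem.** $K_nM_n=L_nK_n$; that is, for all $\lambda\in\Lambda_n$ and $\tilde Z\in\mathbb{K}^{2n}$, $$\sum_{Z\in\mathbb{K}^{2n}}K_n(\lambda,Z)\,M_n(Z,\tilde Z)=\sum_{\mu\in\Lambda_n}L_n(\lambda,\mu)\,K_n(\mu,\tilde Z),$$ where both sums have only finitely many nonzero terms. -/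

import Mathlib

namespace QBerele

noncomputable section

open scoped Classical in
/-- The indicator of a proposition, as a real number. -/
def ind (p : Prop) : ℝ := if p then 1 else 0

/-! ### Partitions and symplectic Gelfand–Tsetlin patterns

A partition is a weakly decreasing sequence of natural numbers with finitely many nonzero terms.
Indices start at `0`: the part `λ_{i+1}` of the usual notation is `lam i`. -/

/-- `lam` is a partition of length at most `n`. -/
structure IsPartition (n : ℕ) (lam : ℕ → ℕ) : Prop where
  anti : Antitone lam
  zero_of_le : ∀ i, n ≤ i → lam i = 0

/-- The set of partitions of length at most `n`. -/
def Part (n : ℕ) : Type := {lam : ℕ → ℕ // IsPartition n lam}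

/-- `x ⪯ y`: the interlacing `y₁ ≥ x₁ ≥ y₂ ≥ x₂ ≥ ⋯`. -/
def Interlaces (x y : ℕ → ℕ) : Prop := ∀ i, x i ≤ y i ∧ y (i + 1) ≤ x i

/-- Symplectic Gelfand–Tsetlin patterns with `N` levels. The levels are `level 1, …, level N`, and
levels `2l - 1` and `2l` are partitions with at most `l` parts. The function `level` is set to zero
outside `1, …, N`, so that a pattern is determined by its levels; in particular `level 0` is the
empty partition. -/
@[ext]
structure GTPattern (N : ℕ) where
  level : ℕ → ℕ → ℕ
  isPartition : ∀ k, 1 ≤ k → k ≤ N → IsPartition ((k + 1) / 2) (level k)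
  interlaces : ∀ k, 1 ≤ k → k < N → Interlaces (level k) (level (k + 1))
  outside : ∀ k, k = 0 ∨ N < k → level k = 0

/-- The weight `|z^k|` of the level `z^k`, which has at most `(k + 1) / 2` nonzero parts. -/
def GTPattern.weight {N : ℕ} (Z : GTPattern N) (k : ℕ) : ℕ :=
  ∑ i ∈ Finset.range ((k + 1) / 2), Z.level k i

/-- The sequence `e_{i+1}`: one in position `i`, zero elsewhere. -/
def e (i : ℕ) : ℕ → ℕ := Pi.single i 1

/-! ### `q`-binomial coefficients -/

/-- `(q;q)_m = ∏_{k=1}^m (1 - q^k)`. -/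
def qPoch (q : ℝ) (m : ℕ) : ℝ := ∏ k ∈ Finset.Icc 1 m, (1 - q ^ k)

/-- The `q`-factorial. -/
def qFact (q : ℝ) (m : ℕ) : ℝ := qPoch q m / (1 - q) ^ m

/-- The `q`-binomial coefficient (used only for `k ≤ m`). -/
def qBinom (q : ℝ) (m k : ℕ) : ℝ := qFact q m / (qFact q k * qFact q (m - k))

/-! ### The kernel `K_n` -/

/-- `a^Z = ∏_{i=1}^n a_i^{2|z^{2i-1}| - |z^{2i}| - |z^{2i-2}|}`. -/
def aPow {n : ℕ} (a : Fin n → ℝ) (Z : GTPattern (2 * n)) : ℝ :=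
  ∏ i : Fin n, a i ^ (2 * (Z.weight (2 * i + 1) : ℤ) - (Z.weight (2 * i + 2) : ℤ)
    - (Z.weight (2 * i) : ℤ))

/-- `κ_n(Z)`; the factor with index `k` here involves the levels `2k`, `2k + 1`, `2k + 2`. -/
def kappa {n : ℕ} (q : ℝ) (Z : GTPattern (2 * n)) : ℝ :=
  ∏ k ∈ Finset.range n,
    (∏ i ∈ Finset.range k,
      (qBinom q (Z.level (2 * k + 1) i - Z.level (2 * k + 1) (i + 1))
          (Z.level (2 * k + 1) i - Z.level (2 * k) i) *
        qBinom q (Z.level (2 * k + 2) i - Z.level (2 * k + 2) (i + 1))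
          (Z.level (2 * k + 2) i - Z.level (2 * k + 1) i))) *
    qBinom q (Z.level (2 * k + 2) k) (Z.level (2 * k + 2) k - Z.level (2 * k + 1) k)

/-- `K_n(λ, Z) = a^Z κ_n(Z) 1_{z^{2n} = λ}`. -/
def K {n : ℕ} (q : ℝ) (a : Fin n → ℝ) (lam : Part n) (Z : GTPattern (2 * n)) : ℝ :=
  aPow a Z * kappa q Z * ind (Z.level (2 * n) = lam.1)

/-! ### The `q`-Pieri operator `L_n` -/

/-- `u^+_{n,i+1}(λ)`. -/
def uPlus (q : ℝ) (lam : ℕ → ℕ) : ℕ → ℝ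
  | 0 => 1
  | i + 1 => 1 - q ^ ((lam i : ℤ) - (lam (i + 1) : ℤ))

/-- `u^-_{n,i+1}(λ)`. For the last index `i = n - 1` one has `lam (i + 1) = 0`, which gives
`1 - q^{λ_n}`. -/
def uMinus (q : ℝ) (lam : ℕ → ℕ) (i : ℕ) : ℝ :=
  1 - q ^ ((lam i : ℤ) - (lam (i + 1) : ℤ))

/-- `L_n(λ, μ)` is `u^+_{n,i}(λ)` if `μ = λ + e_i`, `u^-_{n,i}(λ)` if `μ = λ - e_i`, and zero
otherwise (at most one term of the sum is nonzero). -/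
def L {n : ℕ} (q : ℝ) (lam mu : Part n) : ℝ :=
  ∑ i ∈ Finset.range n,
    (uPlus q lam.1 i * ind (mu.1 = lam.1 + e i) + uMinus q lam.1 i * ind (lam.1 = mu.1 + e i))

/-! ### The `q`-deformed Berele insertion and the kernel `M_n` -/

/-- `r_{i+1}(y;x) = q^{y_i - x_i} (1 - q^{x_{i-1} - y_i}) / (1 - q^{x_{i-1} - x_i})`, where
`x_0 = ∞`, so that `r_1(y;x) = q^{y_1 - x_1}`. -/
def r (q : ℝ) (y x : ℕ → ℕ) : ℕ → ℝ
  | 0 => q ^ ((y 0 : ℤ) - (x 0 : ℤ))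
  | i + 1 => q ^ ((y (i + 1) : ℤ) - (x (i + 1) : ℤ)) *
      ((1 - q ^ ((x i : ℤ) - (y (i + 1) : ℤ))) / (1 - q ^ ((x i : ℤ) - (x (i + 1) : ℤ))))

/-- `l_{i+1}(y;x) = q^{x_i - y_{i+1}} (1 - q^{y_{i+1} - x_{i+1}}) / (1 - q^{x_i - x_{i+1}})`; parts
beyond the length of a partition are zero. -/
def l (q : ℝ) (y x : ℕ → ℕ) (i : ℕ) : ℝ :=
  q ^ ((x i : ℤ) - (y (i + 1) : ℤ)) *
    ((1 - q ^ ((y (i + 1) : ℤ) - (x (i + 1) : ℤ))) / (1 - q ^ ((x i : ℤ) - (x (i + 1) : ℤ))))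

/-- What can happen to a level: its particle number `i + 1` attempts a right jump, or it performs a
left jump. -/
inductive Move where
  | right (i : ℕ)
  | left (i : ℕ)

/-- `propagate q Z Z' m k mv` is the probability that, if the move `mv` takes place at level `k` of
the pattern `Z`, the levels `k, k + 1, …, k + m` of `Z` become those of `Z'`, where `k + m` is the
bottom level. The probabilities met on the way down are multiplied, and the two possible outcomes
at each level are added. A right jump attempted by the last particle of a level with odd number
(`k = 2 * i + 1`) is either performed, pushing the particle below it to the right, or suppressed,
and then that particle is pulled to the left. -/
def propagate (q : ℝ) (Z Z' : ℕ → ℕ → ℕ) : ℕ → ℕ → Move → ℝ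
  | 0, k, .right i => ind (Z' k = Z k + e i)
  | 0, k, .left i => ind (Z k = Z' k + e i)
  | m + 1, k, .right i =>
      if k = 2 * i + 1 then
        r q (Z (k + 1)) (Z k) i * ind (Z' k = Z k + e i) *
            propagate q Z Z' m (k + 1) (.right i)
          + (1 - r q (Z (k + 1)) (Z k) i) * ind (Z' k = Z k) *
            propagate q Z Z' m (k + 1) (.left i)
      else
        ind (Z' k = Z k + e i) *
          (r q (Z (k + 1)) (Z k) i * propagate q Z Z' m (k + 1) (.right i)
            + (1 - r q (Z (k + 1)) (Z k) i) * propagate q Z Z' m (k + 1) (.right (i + 1)))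
  | m + 1, k, .left i =>
      ind (Z k = Z' k + e i) *
        (l q (Z (k + 1)) (Z k) i * propagate q Z Z' m (k + 1) (.left (i + 1))
          + (1 - l q (Z (k + 1)) (Z k) i) * propagate q Z Z' m (k + 1) (.left i))

/-- The alphabet `1 < 1̄ < 2 < 2̄ < ⋯ < n < n̄`: `Sum.inl j` is the letter `j + 1` and `Sum.inr j`
is the barred letter. -/
abbrev Letter (n : ℕ) : Type := Fin n ⊕ Fin n

/-- The position of a letter in the alphabet, counted from `1`. -/
def order {n : ℕ} : Letter n → ℕ
  | .inl j => 2 * j + 1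
  | .inr j => 2 * j + 2

/-- The weight `a_l` of a letter, where a barred letter has the inverse weight. -/
def letterWeight {n : ℕ} (a : Fin n → ℝ) : Letter n → ℝ
  | .inl j => a j
  | .inr j => (a j)⁻¹

/-- `I_l(Z, Z')`: the probability of obtaining `Z'` by inserting the letter `l` in `Z`. The levels
above `order l` stay fixed, and the first particle of the level `order l` attempts a right jump. -/
def insertProb {n : ℕ} (q : ℝ) (c : Letter n) (Z Z' : GTPattern (2 * n)) : ℝ :=
  ind (∀ k < order c, Z'.level k = Z.level k) *
    propagate q Z.level Z'.level (2 * n - order c) (order c) (.right 0)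

/-- `M_n(Z, Z') = ∑_l a_l I_l(Z, Z')`. -/
def M {n : ℕ} (q : ℝ) (a : Fin n → ℝ) (Z Z' : GTPattern (2 * n)) : ℝ :=
  ∑ c : Letter n, letterWeight a c * insertProb q c Z Z'

/-! ### Composition of kernels -/

/-- The composition `(A B)(x, z) = ∑_y A(x, y) B(y, z)`. -/
def comp {X Y W : Type} (A : X → Y → ℝ) (B : Y → W → ℝ) (x : X) (z : W) : ℝ :=
  ∑' y, A x y * B y z

end

end QBerele

/-!
The kernel `K` is a product over neighbouring levels. With `b_k` the weight of the letter of order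
`k`, so that `b_{2i-1} = a_i` and `b_{2i} = 1 / a_i`, the levels `w = z^{k-1}` and `x = z^k`
contribute `b_k^{|x| - |w|} φ(w, x)`, where `φ(w, x)` is the product of the `q`-binomial
coefficients of `x_j - x_{j+1}` over `x_j - w_j` (`aPow_mul_kappa`). Written as
`∏_j (q;q)_{x_j - x_{j+1}} / ((q;q)_{x_j - w_j} (q;q)_{w_j - x_{j+1}})`, with `1 / (q;q)_m = 0` for
`m < 0`, the weight `φ` (`skewWeight`) is defined for all integer sequences, vanishes unless they
interlace, and changes by explicit factors when one particle moves.

Fix the pattern `Z'` that the insertion is to produce. Let `S_k(x, mv)` (`arrivalSum`) be the total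
weight of all `Z` with level `k` equal to `x`, and of all letters of order at most `k`, for which
the levels before `k` become those of `Z'` and the move `mv` is attempted at level `k`. By induction
on `k`, if the move changes `x` into the level `k` of `Z'`, then `S_k(x, mv)` is the rate `u^±` of
the move times the weight of the first `k` levels of `Z'` (`arrivalSum_eq`). For `k = 2n` this is
the theorem. In the inductive step the rate of the move at level `k` cancels the denominators of
the probabilities `r` and `l`, which leaves the two identities `skewWeight_right` and
`skewWeight_left`: each splits a move at level `k + 1` into the part pushed from the particle with
the same index and the part pushed from the preceding one.

The wall modifies this for the last particle of an odd level `k = 2i - 1`. There the rate of a left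
jump to `y` is proportional to `φ(w, y) - φ(w, y + e_i)` instead of `φ(w, y)`. The suppressed right
jumps, which turn into left jumps at the next level, contribute exactly the missing part
(`suppressed_right`), because `b_{k+1} = 1 / b_k`.
-/

namespace QBerele

noncomputable section

/-! ### Interlacing weights extended by zero -/

/-- `(q;q)_m` with an integer index; it is `1` for negative `m`. -/
def poch (q : ℝ) (m : ℤ) : ℝ := qPoch q m.toNat

/-- `1 / (q;q)_m` with an integer index, extended by `0` to negative `m`, as the recursion
`1 / (q;q)_{m-1} = (1 - q^m) / (q;q)_m` demands at `m = 0`. -/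
def pochInv (q : ℝ) (m : ℤ) : ℝ := if m < 0 then 0 else (qPoch q m.toNat)⁻¹

lemma qPoch_succ (q : ℝ) (m : ℕ) : qPoch q (m + 1) = qPoch q m * (1 - q ^ (m + 1)) := by
  unfold qPoch
  rw [Finset.prod_Icc_succ_top (by omega)]

lemma one_sub_zpow_ne_zero {q : ℝ} (hq0 : 0 < q) (hq1 : q < 1) {m : ℤ} (hm : 0 < m) :
    1 - q ^ m ≠ 0 :=
  (sub_pos.2 (zpow_lt_one₀ hq0 hq1 hm)).ne'

lemma qPoch_ne_zero {q : ℝ} (hq0 : 0 < q) (hq1 : q < 1) (m : ℕ) : qPoch q m ≠ 0 := by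
  refine Finset.prod_ne_zero_iff.2 fun k hk => ?_
  have := one_sub_zpow_ne_zero hq0 hq1 (m := k) (by have := (Finset.mem_Icc.1 hk).1; omega)
  simpa using this

lemma poch_add_one (q : ℝ) {m : ℤ} (hm : 0 ≤ m) :
    poch q (m + 1) = (1 - q ^ (m + 1)) * poch q m := by
  lift m to ℕ using hm
  have h : ((m : ℤ) + 1).toNat = m + 1 := by omega
  have h' : q ^ ((m : ℤ) + 1) = q ^ (m + 1) := by exact_mod_cast zpow_natCast q (m + 1)
  simp only [poch, h, h', Int.toNat_natCast, qPoch_succ]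
  ring

lemma pochInv_of_neg (q : ℝ) {m : ℤ} (hm : m < 0) : pochInv q m = 0 := if_pos hm

lemma pochInv_sub_one {q : ℝ} (hq0 : 0 < q) (hq1 : q < 1) (m : ℤ) :
    pochInv q (m - 1) = (1 - q ^ m) * pochInv q m := by
  rcases lt_trichotomy m 0 with hm | rfl | hm
  · rw [pochInv_of_neg q hm, pochInv_of_neg q (by omega), mul_zero]
  · simp [pochInv]
  · obtain ⟨k, rfl⟩ : ∃ k : ℕ, m = k + 1 := ⟨(m - 1).toNat, by omega⟩
    have h : ((k : ℤ) + 1).toNat = k + 1 := by omega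
    have h' : q ^ ((k : ℤ) + 1) = q ^ (k + 1) := by exact_mod_cast zpow_natCast q (k + 1)
    have hne := one_sub_zpow_ne_zero hq0 hq1 hm
    rw [h'] at hne
    have hp := qPoch_ne_zero hq0 hq1 k
    rw [pochInv, pochInv, if_neg (by omega), if_neg (by omega), h', h, qPoch_succ]
    simp only [add_sub_cancel_right, Int.toNat_natCast]
    field_simp

lemma poch_mul_pochInv {q : ℝ} (hq0 : 0 < q) (hq1 : q < 1) {m : ℤ} (hm : 0 ≤ m) :
    poch q m * pochInv q m = 1 := by
  rw [poch, pochInv, if_neg (by omega), mul_inv_cancel₀ (qPoch_ne_zero hq0 hq1 _)]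

lemma qBinom_eq {q : ℝ} (hq1 : q < 1) {m k : ℕ} (hk : k ≤ m) :
    qBinom q m k = poch q m * pochInv q k * pochInv q ((m : ℤ) - k) := by
  have h : ((m : ℤ) - k).toNat = m - k := by omega
  have hq : (1 - q) ≠ 0 := by linarith
  rw [qBinom, poch, pochInv, pochInv, if_neg (by omega), if_neg (by omega), h]
  simp only [qFact, Int.toNat_natCast]
  rw [div_mul_div_comm, ← pow_add, Nat.add_sub_cancel' hk, div_div_div_cancel_right₀ (by positivity)]
  rw [div_eq_mul_inv, mul_inv, mul_assoc]

/-- The factor of `skewWeight` with index `j`: a `q`-binomial coefficient if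
`x (j + 1) ≤ w j ≤ x j`, and zero if `w j` violates these bounds. -/
def skewFactor (q : ℝ) (w x : ℕ → ℤ) (j : ℕ) : ℝ :=
  poch q (x j - x (j + 1)) * pochInv q (x j - w j) * pochInv q (w j - x (j + 1))

/-- The weight of the pair of neighbouring levels `w ⪯ x`: the product of the `q`-binomial
coefficients of `x_j - x_{j+1}` over `x_j - w_j`, for the first `n` parts. The sequences are integer
valued so that the weight is defined, and zero, when a particle leaves its allowed range. -/
def skewWeight (q : ℝ) (n : ℕ) (w x : ℕ → ℤ) : ℝ := ∏ j ∈ Finset.range n, skewFactor q w x j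

/-- The integer valued sequence with one in position `i` and zero elsewhere. -/
def unitAt (i : ℕ) : ℕ → ℤ := Pi.single i 1

@[simp] lemma unitAt_self (i : ℕ) : unitAt i i = 1 := by simp [unitAt]

lemma unitAt_of_ne {i j : ℕ} (h : j ≠ i) : unitAt i j = 0 := by simp [unitAt, h]

/-- Products over `range n` of functions that agree away from `i` have a common cofactor. -/
lemma exists_cofactor {n i : ℕ} (hi : i < n) (F₀ : ℕ → ℝ) :
    ∃ C, ∀ F : ℕ → ℝ, (∀ j, j ≠ i → F j = F₀ j) → ∏ j ∈ Finset.range n, F j = F i * C := by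
  refine ⟨∏ j ∈ (Finset.range n).erase i, F₀ j, fun F hF => ?_⟩
  rw [← Finset.mul_prod_erase _ _ (Finset.mem_range.2 hi)]
  congr 1
  exact Finset.prod_congr rfl fun j hj => hF j (Finset.ne_of_mem_erase hj)

lemma exists_cofactor_pair {n i : ℕ} (hi : i + 1 < n) (F₀ : ℕ → ℝ) :
    ∃ C, ∀ F : ℕ → ℝ, (∀ j, j ≠ i → j ≠ i + 1 → F j = F₀ j) →
      ∏ j ∈ Finset.range n, F j = F i * F (i + 1) * C := by
  refine ⟨∏ j ∈ ((Finset.range n).erase i).erase (i + 1), F₀ j, fun F hF => ?_⟩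
  rw [← Finset.mul_prod_erase _ _ (Finset.mem_range.2 (by omega : i < n)),
    ← Finset.mul_prod_erase ((Finset.range n).erase i) _ (a := i + 1) (by simp; omega), ← mul_assoc]
  congr 1
  refine Finset.prod_congr rfl fun j hj => ?_
  simp only [Finset.mem_erase] at hj
  exact hF j hj.2.1 hj.1

lemma skewWeight_sub_unitAt {q : ℝ} (hq0 : 0 < q) (hq1 : q < 1) {n i : ℕ} (hi : i < n)
    (w x : ℕ → ℤ) :
    (1 - q ^ (x i - w i + 1)) * skewWeight q n (w - unitAt i) x =
      (1 - q ^ (w i - x (i + 1))) * skewWeight q n w x := by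
  obtain ⟨C, hC⟩ := exists_cofactor hi (skewFactor q w x)
  rw [skewWeight, skewWeight, hC (skewFactor q w x) (fun _ _ => rfl),
    hC (skewFactor q (w - unitAt i) x) (fun j hj => by simp [skewFactor, unitAt_of_ne hj])]
  simp only [skewFactor, Pi.sub_apply, unitAt_self]
  have h1 := pochInv_sub_one hq0 hq1 (x i - w i + 1)
  have h2 := pochInv_sub_one hq0 hq1 (w i - x (i + 1))
  rw [show x i - w i + 1 - 1 = x i - w i by ring] at h1
  rw [show x i - (w i - 1) = x i - w i + 1 by ring,
    show w i - 1 - x (i + 1) = w i - x (i + 1) - 1 by ring, h1, h2]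
  ring

lemma skewWeight_add_unitAt {q : ℝ} (hq0 : 0 < q) (hq1 : q < 1) {n i : ℕ} (hi : i < n)
    (w x : ℕ → ℤ) :
    (1 - q ^ (w i + 1 - x (i + 1))) * skewWeight q n (w + unitAt i) x =
      (1 - q ^ (x i - w i)) * skewWeight q n w x := by
  have h := skewWeight_sub_unitAt hq0 hq1 hi (w + unitAt i) x
  simp only [add_sub_cancel_right, Pi.add_apply, unitAt_self] at h
  rw [show x i - (w i + 1) + 1 = x i - w i by ring] at h
  exact h.symm

/-- `1 - q^{w_{i-1} - x_i}`, with the convention `w_{-1} = ∞`. -/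
def gapAbove (q : ℝ) (w x : ℕ → ℤ) : ℕ → ℝ
  | 0 => 1
  | i + 1 => 1 - q ^ (w i - x (i + 1))

/-- The weight after a move of `x_i` to the right, times the rate `gapAbove q x x i` of this move.
The first summand on the left side is due to a push from `w_{i-1}` (or to the inserted letter, for
`i = 0`), the second one to a push from `w_i`. -/
lemma skewWeight_right {q : ℝ} (hq0 : 0 < q) (hq1 : q < 1) {n i : ℕ} (hi : i < n)
    (w x : ℕ → ℤ) (h1 : x (i + 1) ≤ x i) (h2 : ∀ j, i = j + 1 → x i < x j) :
    gapAbove q w x i * (skewWeight q n w x +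
        q ^ (x i - w i + 1) * skewWeight q n (w - unitAt i) x) =
      gapAbove q x x i * skewWeight q n w (x + unitAt i) := by
  have e1 := pochInv_sub_one hq0 hq1 (x i - w i + 1)
  have e2 := pochInv_sub_one hq0 hq1 (w i - x (i + 1))
  have e3 := poch_add_one q (m := x i - x (i + 1)) (by omega)
  have e4 : q ^ (x i - w i + 1) * q ^ (w i - x (i + 1)) = q ^ (x i - x (i + 1) + 1) := by
    rw [← zpow_add₀ hq0.ne']; congr 1; ring
  rw [show x i - w i + 1 - 1 = x i - w i by ring] at e1
  cases i with
  | zero =>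
    obtain ⟨C, hC⟩ := exists_cofactor hi (skewFactor q w x)
    rw [skewWeight, skewWeight, skewWeight, hC (skewFactor q w x) (fun _ _ => rfl),
      hC (skewFactor q (w - unitAt 0) x) (fun j hj => by simp [skewFactor, unitAt_of_ne hj]),
      hC (skewFactor q w (x + unitAt 0)) (fun j hj => by
        simp [skewFactor, unitAt_of_ne hj, unitAt_of_ne (show j + 1 ≠ 0 by omega)])]
    simp only [skewFactor, Pi.sub_apply, Pi.add_apply, unitAt_self, gapAbove,
      unitAt_of_ne (show 0 + 1 ≠ 0 by omega), add_zero]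
    rw [show x 0 - (w 0 - 1) = x 0 - w 0 + 1 by ring,
      show w 0 - 1 - x (0 + 1) = w 0 - x (0 + 1) - 1 by ring,
      show x 0 + 1 - x (0 + 1) = x 0 - x (0 + 1) + 1 by ring,
      show x 0 + 1 - w 0 = x 0 - w 0 + 1 by ring, e1, e2, e3, ← e4]
    ring
  | succ i =>
    have e5 := pochInv_sub_one hq0 hq1 (w i - x (i + 1))
    have e6 := poch_add_one q (m := x i - x (i + 1) - 1) (by have := h2 i rfl; omega)
    rw [show x i - x (i + 1) - 1 + 1 = x i - x (i + 1) by ring] at e6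
    obtain ⟨C, hC⟩ := exists_cofactor_pair hi (skewFactor q w x)
    rw [skewWeight, skewWeight, skewWeight, hC (skewFactor q w x) (fun _ _ _ => rfl),
      hC (skewFactor q (w - unitAt (i + 1)) x)
        (fun j _ hj => by simp [skewFactor, unitAt_of_ne hj]),
      hC (skewFactor q w (x + unitAt (i + 1))) (fun j hj hj' => by
        simp [skewFactor, unitAt_of_ne hj', unitAt_of_ne (show j + 1 ≠ i + 1 by omega)])]
    simp only [skewFactor, Pi.sub_apply, Pi.add_apply, unitAt_self, gapAbove,
      unitAt_of_ne (show i + 1 + 1 ≠ i + 1 by omega), unitAt_of_ne (show i ≠ i + 1 by omega),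
      add_zero, sub_zero]
    rw [show x (i + 1) - (w (i + 1) - 1) = x (i + 1) - w (i + 1) + 1 by ring,
      show w (i + 1) - 1 - x (i + 1 + 1) = w (i + 1) - x (i + 1 + 1) - 1 by ring,
      show x (i + 1) + 1 - x (i + 1 + 1) = x (i + 1) - x (i + 1 + 1) + 1 by ring,
      show x (i + 1) + 1 - w (i + 1) = x (i + 1) - w (i + 1) + 1 by ring,
      show x i - (x (i + 1) + 1) = x i - x (i + 1) - 1 by ring,
      show w i - (x (i + 1) + 1) = w i - x (i + 1) - 1 by ring, e1, e2, e3, e5, e6, ← e4]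
    ring

/-- `q^{w_{i-1} + 1 - x_i}` times the weight of `w + e_{i-1}` and `x`, and zero for `i = 0`: the
contribution of a level `w + e_{i-1}` that jumps left to `w` and pulls `x_i`. -/
def pushLeft (q : ℝ) (n : ℕ) (w x : ℕ → ℤ) : ℕ → ℝ
  | 0 => 0
  | i + 1 => q ^ (w i + 1 - x (i + 1)) * skewWeight q n (w + unitAt i) x

/-- The weight after a move of `x_i` to the left, times the rate of this move. The first summand on
the left side is due to a pull from `w_i`, the second one to a pull from `w_{i-1}`. -/
lemma skewWeight_left {q : ℝ} (hq0 : 0 < q) (hq1 : q < 1) {n i : ℕ} (hi : i < n)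
    (w x : ℕ → ℤ) (h1 : x (i + 1) < x i) (h2 : ∀ j, i = j + 1 → x i ≤ x j) :
    (1 - q ^ (x i - w i)) * (skewWeight q n w x + pushLeft q n w x i) =
      (1 - q ^ (x i - x (i + 1))) * skewWeight q n w (x - unitAt i) := by
  have e1 := pochInv_sub_one hq0 hq1 (x i - w i)
  have e3 := poch_add_one q (m := x i - x (i + 1) - 1) (by omega)
  rw [show x i - x (i + 1) - 1 + 1 = x i - x (i + 1) by ring] at e3
  cases i with
  | zero =>
    obtain ⟨C, hC⟩ := exists_cofactor hi (skewFactor q w x)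
    rw [skewWeight, skewWeight, hC (skewFactor q w x) (fun _ _ => rfl),
      hC (skewFactor q w (x - unitAt 0)) (fun j hj => by
        simp [skewFactor, unitAt_of_ne hj, unitAt_of_ne (show j + 1 ≠ 0 by omega)])]
    simp only [skewFactor, Pi.sub_apply, unitAt_self, pushLeft,
      unitAt_of_ne (show 0 + 1 ≠ 0 by omega), add_zero, sub_zero]
    rw [show x 0 - 1 - x (0 + 1) = x 0 - x (0 + 1) - 1 by ring,
      show x 0 - 1 - w 0 = x 0 - w 0 - 1 by ring, e1, e3]
    ring
  | succ i =>
    have e2 := pochInv_sub_one hq0 hq1 (w i + 1 - x (i + 1))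
    have e4 := pochInv_sub_one hq0 hq1 (x i - w i)
    have e5 := poch_add_one q (m := x i - x (i + 1)) (by have := h2 i rfl; omega)
    have e6 : q ^ (w i + 1 - x (i + 1)) * q ^ (x i - w i) = q ^ (x i - x (i + 1) + 1) := by
      rw [← zpow_add₀ hq0.ne']; congr 1; ring
    rw [show w i + 1 - x (i + 1) - 1 = w i - x (i + 1) by ring] at e2
    obtain ⟨C, hC⟩ := exists_cofactor_pair hi (skewFactor q w x)
    rw [pushLeft, skewWeight, skewWeight, skewWeight, hC (skewFactor q w x) (fun _ _ _ => rfl),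
      hC (skewFactor q (w + unitAt i) x)
        (fun j hj _ => by simp [skewFactor, unitAt_of_ne hj]),
      hC (skewFactor q w (x - unitAt (i + 1))) (fun j hj hj' => by
        simp [skewFactor, unitAt_of_ne hj', unitAt_of_ne (show j + 1 ≠ i + 1 by omega)])]
    simp only [skewFactor, Pi.sub_apply, Pi.add_apply, unitAt_self,
      unitAt_of_ne (show i + 1 + 1 ≠ i + 1 by omega), unitAt_of_ne (show i ≠ i + 1 by omega),
      unitAt_of_ne (show i + 1 ≠ i by omega), add_zero, sub_zero]
    rw [show x i - (w i + 1) = x i - w i - 1 by ring,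
      show x (i + 1) - 1 - x (i + 1 + 1) = x (i + 1) - x (i + 1 + 1) - 1 by ring,
      show x (i + 1) - 1 - w (i + 1) = x (i + 1) - w (i + 1) - 1 by ring,
      show x i - (x (i + 1) - 1) = x i - x (i + 1) + 1 by ring,
      show w i - (x (i + 1) - 1) = w i + 1 - x (i + 1) by ring, e1, e2, e3, e4, e5, ← e6]
    ring

/-! ### Sums over patterns with a given last level -/

lemma ind_of {p : Prop} (h : p) : ind p = 1 := if_pos h

lemma ind_of_not {p : Prop} (h : ¬p) : ind p = 0 := if_neg h

lemma upperLevels_finite (k : ℕ) (x : ℕ → ℕ) :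
    {w : ℕ → ℕ | IsPartition ((k + 1) / 2) w ∧ Interlaces w x}.Finite := by
  refine Set.Finite.of_finite_image (f := fun w (i : Fin ((k + 1) / 2)) => w i)
    ((Set.finite_Iic (fun i : Fin ((k + 1) / 2) => x i)).subset ?_) ?_
  · rintro _ ⟨w, hw, rfl⟩ i
    exact (hw.2 i).1
  · intro w hw v hv h
    funext i
    by_cases hi : i < (k + 1) / 2
    · exact congrFun h ⟨i, hi⟩
    · rw [hw.1.zero_of_le i (by omega), hv.1.zero_of_le i (by omega)]

/-- The possible levels `k` above the level `x` with number `k + 1`. -/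
def upperLevels (k : ℕ) (x : ℕ → ℕ) : Finset (ℕ → ℕ) := (upperLevels_finite k x).toFinset

lemma mem_upperLevels {k : ℕ} {x w : ℕ → ℕ} :
    w ∈ upperLevels k x ↔ IsPartition ((k + 1) / 2) w ∧ Interlaces w x := by
  simp [upperLevels]

open scoped Classical in
/-- The patterns with `k` levels and last level `x`, as sequences of levels that vanish after the
last one. -/
def patterns : ℕ → (ℕ → ℕ) → Finset (ℕ → ℕ → ℕ)
  | 0, _ => {0}
  | k + 1, x => (upperLevels k x).biUnion fun w =>
      (patterns k w).image fun Z => Function.update Z (k + 1) x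

lemma mem_patterns {k : ℕ} {x : ℕ → ℕ} (hx : IsPartition ((k + 1) / 2) x) {Z : ℕ → ℕ → ℕ} :
    Z ∈ patterns k x ↔ (∀ j, 1 ≤ j → j ≤ k → IsPartition ((j + 1) / 2) (Z j)) ∧
      (∀ j, 1 ≤ j → j < k → Interlaces (Z j) (Z (j + 1))) ∧
      (∀ j, j = 0 ∨ k < j → Z j = 0) ∧ Z k = x := by
  induction k generalizing x Z with
  | zero =>
    have hx0 : x = 0 := funext fun i => hx.zero_of_le i (Nat.zero_le _)
    simp only [patterns, Finset.mem_singleton, hx0]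
    constructor
    · rintro rfl
      exact ⟨fun j h1 h2 => by omega, fun j h1 h2 => by omega, fun _ _ => rfl, rfl⟩
    · rintro ⟨-, -, h, -⟩
      exact funext fun j => h j (by omega)
  | succ k ih =>
    simp only [patterns, Finset.mem_biUnion, Finset.mem_image, mem_upperLevels]
    constructor
    · rintro ⟨w, ⟨hw, hwx⟩, Z₀, hZ₀, rfl⟩
      obtain ⟨h1, h2, h3, h4⟩ := (ih hw).1 hZ₀
      refine ⟨fun j hj hjk => ?_, fun j hj hjk => ?_, fun j hj => ?_, by simp⟩
      · rcases eq_or_ne j (k + 1) with rfl | hne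
        · simpa using hx
        · rw [Function.update_of_ne hne]
          exact h1 j hj (by omega)
      · rw [Function.update_of_ne (show j ≠ k + 1 by omega)]
        rcases eq_or_ne j k with rfl | hne
        · simpa [h4] using hwx
        · rw [Function.update_of_ne (by omega)]
          exact h2 j hj (by omega)
      · rw [Function.update_of_ne (by omega)]
        exact h3 j (by omega)
    · rintro ⟨h1, h2, h3, h4⟩
      have hw : IsPartition ((k + 1) / 2) (Z k) := by
        rcases Nat.eq_zero_or_pos k with rfl | hk
        · rw [h3 0 (Or.inl rfl)]
          exact ⟨fun _ _ _ => le_rfl, fun _ _ => rfl⟩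
        · exact h1 k hk (by omega)
      refine ⟨Z k, ⟨hw, ?_⟩, Function.update Z (k + 1) 0,
        (ih hw).2 ⟨fun j hj hjk => ?_, fun j hj hjk => ?_, fun j hj => ?_, ?_⟩, ?_⟩
      · rcases Nat.eq_zero_or_pos k with rfl | hk
        · rw [h3 0 (Or.inl rfl)]
          exact fun i => ⟨Nat.zero_le _, (hx.zero_of_le (i + 1) (by omega)).le⟩
        · rw [← h4]
          exact h2 k hk (by omega)
      · rw [Function.update_of_ne (by omega)]
        exact h1 j hj (by omega)
      · rw [Function.update_of_ne (by omega), Function.update_of_ne (by omega)]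
        exact h2 j hj (by omega)
      · rcases eq_or_ne j (k + 1) with rfl | hne
        · simp
        · rw [Function.update_of_ne hne]
          exact h3 j (by omega)
      · rw [Function.update_of_ne (by omega)]
      · rw [Function.update_idem, ← h4, Function.update_eq_self]

lemma sum_patterns_succ (k : ℕ) (x : ℕ → ℕ) (f : (ℕ → ℕ → ℕ) → ℝ) :
    ∑ Z ∈ patterns (k + 1) x, f Z =
      ∑ w ∈ upperLevels k x, ∑ Z ∈ patterns k w, f (Function.update Z (k + 1) x) := by
  classical
  have hlast : ∀ w ∈ upperLevels k x, ∀ Z ∈ patterns k w, Z k = w ∧ Z (k + 1) = 0 :=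
    fun w hw Z hZ => by
      have h := (mem_patterns (mem_upperLevels.1 hw).1).1 hZ
      exact ⟨h.2.2.2, h.2.2.1 _ (by omega)⟩
  rw [patterns, Finset.sum_biUnion]
  · refine Finset.sum_congr (by congr) fun w hw => ?_
    convert Finset.sum_image (f := f) ?_
    intro Z hZ Y hY h
    have hZ' := (hlast w hw Z hZ).2
    have hY' := (hlast w hw Y hY).2
    have := congrArg (fun V => Function.update V (k + 1) 0) h
    simp only [Function.update_idem] at this
    rwa [← hZ', Function.update_eq_self, hZ', ← hY', Function.update_eq_self] at this
  · intro w hw v hv hne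
    rw [Function.onFun, Finset.disjoint_left]
    intro Y hY hY'
    obtain ⟨Z, hZ, rfl⟩ := Finset.mem_image.1 hY
    obtain ⟨V, hV, hVZ⟩ := Finset.mem_image.1 hY'
    have h := congrFun hVZ k
    rw [Function.update_of_ne (by omega), Function.update_of_ne (by omega),
      (hlast v hv V hV).1, (hlast w hw Z hZ).1] at h
    exact hne h.symm

lemma GTPattern.isPartition_level {N : ℕ} (Z : GTPattern N) {k : ℕ} (hk : k ≤ N) :
    IsPartition ((k + 1) / 2) (Z.level k) := by
  rcases Nat.eq_zero_or_pos k with rfl | h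
  · rw [Z.outside 0 (Or.inl rfl)]
    exact ⟨fun _ _ _ => le_rfl, fun _ _ => rfl⟩
  · exact Z.isPartition k h hk

lemma GTPattern.interlaces_level {N : ℕ} (Z : GTPattern N) {k : ℕ} (hk : k < N) :
    Interlaces (Z.level k) (Z.level (k + 1)) := by
  rcases Nat.eq_zero_or_pos k with rfl | h
  · rw [Z.outside 0 (Or.inl rfl)]
    exact fun i => ⟨Nat.zero_le _, ((Z.isPartition_level hk).zero_of_le (i + 1) (by omega)).le⟩
  · exact Z.interlaces k h hk

lemma GTPattern.level_injective (N : ℕ) : Function.Injective (GTPattern.level (N := N)) :=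
  fun _ _ h => GTPattern.ext h

lemma GTPattern.level_mem_patterns {N : ℕ} (Z : GTPattern N) :
    Z.level ∈ patterns N (Z.level N) :=
  (mem_patterns (Z.isPartition_level le_rfl)).2 ⟨Z.isPartition, Z.interlaces, Z.outside, rfl⟩

lemma exists_level_eq {N : ℕ} {x : ℕ → ℕ} (hx : IsPartition ((N + 1) / 2) x) {Z : ℕ → ℕ → ℕ}
    (hZ : Z ∈ patterns N x) : ∃ Y : GTPattern N, Y.level = Z :=
  have h := (mem_patterns hx).1 hZ
  ⟨⟨Z, h.1, h.2.1, h.2.2.1⟩, rfl⟩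

lemma finite_level_eq {N : ℕ} (x : ℕ → ℕ) : {Z : GTPattern N | Z.level N = x}.Finite := by
  refine ((patterns N x).finite_toSet.preimage (f := GTPattern.level (N := N))
    (GTPattern.level_injective N).injOn).subset ?_
  rintro Z rfl
  exact Z.level_mem_patterns

lemma tsum_ind_level {N : ℕ} {x : ℕ → ℕ} (hx : IsPartition ((N + 1) / 2) x)
    (f : (ℕ → ℕ → ℕ) → ℝ) :
    ∑' Z : GTPattern N, ind (Z.level N = x) * f Z.level = ∑ Z ∈ patterns N x, f Z := by
  classical
  rw [tsum_eq_sum (s := (patterns N x).preimage GTPattern.level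
    (GTPattern.level_injective N).injOn)]
  · rw [← Finset.sum_preimage (f := GTPattern.level (N := N)) (patterns N x)
      (GTPattern.level_injective N).injOn f]
    · refine Finset.sum_congr rfl fun Z hZ => ?_
      rw [ind_of ((mem_patterns hx).1 (Finset.mem_preimage.1 hZ)).2.2.2, one_mul]
    · intro Z hZ hne
      exact absurd (exists_level_eq hx hZ) hne
  · intro Z hZ
    rw [ind_of_not, zero_mul]
    rintro rfl
    exact hZ (Finset.mem_preimage.2 Z.level_mem_patterns)

/-! ### The insertion, read from the top level downwards -/

/-- The sequence `0, F 0, F 1, …`. -/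
def shift (F : ℕ → ℝ) : ℕ → ℝ
  | 0 => 0
  | i + 1 => F i

lemma sum_shift_mul (F G : ℕ → ℝ) {B : ℕ} (hF : ∀ i, i + 1 = B → F i = 0) :
    ∑ i ∈ Finset.range B, shift F i * G i = ∑ i ∈ Finset.range B, F i * G (i + 1) := by
  cases B with
  | zero => simp
  | succ B =>
    rw [Finset.sum_range_succ', Finset.sum_range_succ, hF B rfl]
    simp [shift]

/-- The total weight, over all letters of order at most `k` inserted in `Z`, of the event that the
levels before `k` become those of `Z'` and the move `mv` is attempted at level `k`. The weight of
the letter of order `k` is `b k`. -/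
def arrival (q : ℝ) (b : ℕ → ℝ) (Z Z' : ℕ → ℕ → ℕ) : ℕ → Move → ℝ
  | 0, _ => 0
  | k + 1, .right i =>
      (if i = 0 then b (k + 1) * ind (∀ j < k + 1, Z' j = Z j) else 0)
        + r q (Z (k + 1)) (Z k) i * ind (Z' k = Z k + e i) * arrival q b Z Z' k (.right i)
        + shift (fun j => if k = 2 * j + 1 then 0 else
            (1 - r q (Z (k + 1)) (Z k) j) * ind (Z' k = Z k + e j) *
              arrival q b Z Z' k (.right j)) i
  | k + 1, .left i =>
      (1 - l q (Z (k + 1)) (Z k) i) * ind (Z k = Z' k + e i) * arrival q b Z Z' k (.left i)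
        + (if k = 2 * i + 1 then
            (1 - r q (Z (k + 1)) (Z k) i) * ind (Z' k = Z k) * arrival q b Z Z' k (.right i)
          else 0)
        + shift (fun j => l q (Z (k + 1)) (Z k) j * ind (Z k = Z' k + e j) *
            arrival q b Z Z' k (.left j)) i

lemma arrival_eq_zero (q : ℝ) (b : ℕ → ℝ) (Z Z' : ℕ → ℕ → ℕ) {k i : ℕ} (hi : k ≤ i) :
    arrival q b Z Z' k (.right i) = 0 ∧ arrival q b Z Z' k (.left i) = 0 := by
  induction k generalizing i with
  | zero => exact ⟨rfl, rfl⟩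
  | succ k ih =>
    obtain ⟨i, rfl⟩ : ∃ j, i = j + 1 := ⟨i - 1, by omega⟩
    simp [arrival, shift, ih (i := i) (by omega), ih (i := i + 1) (by omega)]

/-- `arrival` depends only on the levels up to `k` of the pattern. -/
lemma arrival_congr (q : ℝ) (b : ℕ → ℝ) {Y Z : ℕ → ℕ → ℕ} (Z' : ℕ → ℕ → ℕ) {k : ℕ}
    (h : ∀ j ≤ k, Y j = Z j) (mv : Move) : arrival q b Y Z' k mv = arrival q b Z Z' k mv := by
  induction k generalizing mv with
  | zero => rfl
  | succ k ih =>
    have ih' := ih fun j hj => h j (by omega)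
    have hp : (∀ j < k + 1, Z' j = Y j) ↔ ∀ j < k + 1, Z' j = Z j :=
      forall₂_congr fun j hj => by rw [h j (by omega)]
    cases mv <;> simp only [arrival, ih', h k (by omega), h (k + 1) le_rfl, hp]

/-- Passing the description of the insertion through one level. -/
lemma sum_arrival_succ (q : ℝ) (b : ℕ → ℝ) (Z Z' : ℕ → ℕ → ℕ) {k B : ℕ} (hB : k < B) (m : ℕ) :
    ∑ i ∈ Finset.range B,
        (arrival q b Z Z' (k + 1) (.right i) * propagate q Z Z' m (k + 1) (.right i) +
          arrival q b Z Z' (k + 1) (.left i) * propagate q Z Z' m (k + 1) (.left i)) =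
      b (k + 1) * (ind (∀ j < k + 1, Z' j = Z j) * propagate q Z Z' m (k + 1) (.right 0)) +
      ∑ i ∈ Finset.range B,
        (arrival q b Z Z' k (.right i) * propagate q Z Z' (m + 1) k (.right i) +
          arrival q b Z Z' k (.left i) * propagate q Z Z' (m + 1) k (.left i)) := by
  simp only [arrival, add_mul, Finset.sum_add_distrib]
  rw [sum_shift_mul, sum_shift_mul]
  · have h0 : ∑ i ∈ Finset.range B, (if i = 0 then b (k + 1) * ind (∀ j < k + 1, Z' j = Z j)
        else 0) * propagate q Z Z' m (k + 1) (.right i) =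
        b (k + 1) * (ind (∀ j < k + 1, Z' j = Z j) * propagate q Z Z' m (k + 1) (.right 0)) := by
      simp only [ite_mul, zero_mul]
      rw [Finset.sum_ite_eq' (Finset.range B) 0, if_pos (Finset.mem_range.2 (by omega)), mul_assoc]
    rw [h0]
    simp only [add_assoc, add_right_inj]
    simp only [← Finset.sum_add_distrib]
    refine Finset.sum_congr rfl fun i _ => ?_
    by_cases hk : k = 2 * i + 1
    · simp only [propagate, if_pos hk]
      ring
    · simp only [propagate, if_neg hk]
      ring
  · intro i hi
    rw [(arrival_eq_zero q b Z Z' (show k ≤ i by omega)).2, mul_zero]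
  · intro i hi
    rw [(arrival_eq_zero q b Z Z' (show k ≤ i by omega)).1, mul_zero, ite_self]

lemma sum_arrival (q : ℝ) (b : ℕ → ℝ) (Z Z' : ℕ → ℕ → ℕ) {N B k : ℕ} (hB : N < B) (hk : k ≤ N) :
    ∑ i ∈ Finset.range B,
        (arrival q b Z Z' k (.right i) * propagate q Z Z' (N - k) k (.right i) +
          arrival q b Z Z' k (.left i) * propagate q Z Z' (N - k) k (.left i)) =
      ∑ j ∈ Finset.range k, b (j + 1) * (ind (∀ i < j + 1, Z' i = Z i) *
        propagate q Z Z' (N - (j + 1)) (j + 1) (.right 0)) := by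
  induction k with
  | zero => simp [arrival]
  | succ k ih =>
    rw [sum_arrival_succ q b Z Z' (by omega), Finset.sum_range_succ, ← ih (by omega),
      show N - (k + 1) + 1 = N - k by omega, add_comm]

/-- The weight of the letter of order `k`. -/
def orderWeight {n : ℕ} (a : Fin n → ℝ) (k : ℕ) : ℝ :=
  if h : (k - 1) / 2 < n then
    if k % 2 = 1 then a ⟨(k - 1) / 2, h⟩ else (a ⟨(k - 1) / 2, h⟩)⁻¹
  else 1

lemma orderWeight_odd {n : ℕ} (a : Fin n → ℝ) (i : Fin n) :
    orderWeight a (2 * i + 1) = a i := by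
  simp [orderWeight, Nat.add_mod]

lemma orderWeight_even {n : ℕ} (a : Fin n → ℝ) (i : Fin n) :
    orderWeight a (2 * i + 2) = (a i)⁻¹ := by
  have h : (2 * (i : ℕ) + 1) / 2 = i := by omega
  simp [orderWeight, h]

lemma orderWeight_pos {n : ℕ} {a : Fin n → ℝ} (ha : ∀ i, 0 < a i) (k : ℕ) :
    0 < orderWeight a k := by
  unfold orderWeight
  split_ifs
  · exact ha _
  · exact inv_pos.2 (ha _)
  · exact one_pos

/-- Consecutive letters `l`, `l̄` have inverse weights. -/
lemma orderWeight_succ {n : ℕ} (a : Fin n → ℝ) (i : ℕ) :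
    orderWeight a (2 * i + 1 + 1) = (orderWeight a (2 * i + 1))⁻¹ := by
  have h : (2 * i + 1 + 1 - 1) / 2 = i := by omega
  have h' : (2 * i + 1 + 1) % 2 = 0 := by omega
  have h'' : (2 * i + 1) % 2 = 1 := by omega
  simp only [orderWeight, h, h', h'']
  by_cases hi : i < n <;> simp [hi]

lemma sum_range_two_mul {A : Type*} [AddCommMonoid A] (f : ℕ → A) (n : ℕ) :
    ∑ j ∈ Finset.range (2 * n), f j = ∑ i ∈ Finset.range n, (f (2 * i) + f (2 * i + 1)) := by
  induction n with
  | zero => simp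
  | succ n ih =>
    rw [Finset.sum_range_succ, ← ih, Nat.mul_succ, Finset.sum_range_succ, Finset.sum_range_succ,
      add_assoc]

lemma M_eq_sum_arrival {n : ℕ} (q : ℝ) (a : Fin n → ℝ) (Z Z' : GTPattern (2 * n)) :
    M q a Z Z' = ∑ i ∈ Finset.range (2 * n + 1),
      (arrival q (orderWeight a) Z.level Z'.level (2 * n) (.right i) *
          ind (Z'.level (2 * n) = Z.level (2 * n) + e i) +
        arrival q (orderWeight a) Z.level Z'.level (2 * n) (.left i) *
          ind (Z.level (2 * n) = Z'.level (2 * n) + e i)) := by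
  have h := sum_arrival q (orderWeight a) Z.level Z'.level (Nat.lt_succ_self (2 * n)) le_rfl
  simp only [Nat.sub_self, propagate] at h
  rw [h, sum_range_two_mul, M, Fintype.sum_sum_type, ← Finset.sum_add_distrib,
    Finset.sum_range (n := n)]
  refine Finset.sum_congr rfl fun i _ => ?_
  rw [orderWeight_odd, show 2 * (i : ℕ) + 1 + 1 = 2 * i + 2 from rfl, orderWeight_even]
  rfl

/-! ### Weights of patterns -/

/-- A sequence of natural numbers, as an integer sequence. -/
def toInt (x : ℕ → ℕ) : ℕ → ℤ := fun j => x j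

lemma toInt_injective : Function.Injective toInt := fun x y h =>
  funext fun j => by simpa [toInt] using congrFun h j

lemma toInt_add_e (x : ℕ → ℕ) (i : ℕ) : toInt (x + e i) = toInt x + unitAt i := by
  funext j
  by_cases h : j = i
  · subst h; simp [toInt, e]
  · simp [toInt, e, unitAt, h]

/-- The sum of the first `n` parts. -/
def size (n : ℕ) (x : ℕ → ℕ) : ℤ := ∑ j ∈ Finset.range n, (x j : ℤ)

lemma size_add_e {n i : ℕ} (hi : i < n) (x : ℕ → ℕ) : size n (x + e i) = size n x + 1 := by
  simp only [size, e, Pi.add_apply, Nat.cast_add, Finset.sum_add_distrib, Pi.single_apply]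
  simp [hi]

/-- The contribution to the weight of a pattern of the passage from a level `w` to the next level
`x`, where `c` is the weight of the letter whose order is the number of the level `x`. -/
def levelFactor (q : ℝ) (n : ℕ) (c : ℝ) (w x : ℕ → ℕ) : ℝ :=
  c ^ (size n x - size n w) * skewWeight q n (toInt w) (toInt x)

/-- The weight of the first `k` levels of a pattern. -/
def pathWeight (q : ℝ) (n : ℕ) (b : ℕ → ℝ) (k : ℕ) (Z : ℕ → ℕ → ℕ) : ℝ :=
  ∏ j ∈ Finset.range k, levelFactor q n (b (j + 1)) (Z j) (Z (j + 1))

lemma pathWeight_succ (q : ℝ) (n : ℕ) (b : ℕ → ℝ) (k : ℕ) (Z : ℕ → ℕ → ℕ) :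
    pathWeight q n b (k + 1) Z =
      pathWeight q n b k Z * levelFactor q n (b (k + 1)) (Z k) (Z (k + 1)) :=
  Finset.prod_range_succ _ _

lemma pathWeight_update (q : ℝ) (n : ℕ) (b : ℕ → ℝ) (k : ℕ) (Z : ℕ → ℕ → ℕ) (x : ℕ → ℕ) :
    pathWeight q n b k (Function.update Z (k + 1) x) = pathWeight q n b k Z := by
  refine Finset.prod_congr rfl fun j hj => ?_
  have := Finset.mem_range.1 hj
  rw [Function.update_of_ne (by omega), Function.update_of_ne (by omega)]

lemma bounds_of_skewWeight_ne_zero {q : ℝ} {n : ℕ} {v x : ℕ → ℤ} (h : skewWeight q n v x ≠ 0)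
    {j : ℕ} (hj : j < n) : x (j + 1) ≤ v j ∧ v j ≤ x j := by
  have hf := Finset.prod_ne_zero_iff.1 h j (Finset.mem_range.2 hj)
  constructor <;> by_contra! hlt
  · exact hf (by rw [skewFactor, pochInv_of_neg q (m := v j - x (j + 1)) (by omega), mul_zero])
  · exact hf (by rw [skewFactor, pochInv_of_neg q (m := x j - v j) (by omega), mul_zero, zero_mul])

/-- A sum over the levels above `x` that is concentrated on one integer sequence `v` gives the
weight of `v`, even if `v` does not interlace with `x`, since that weight is then zero. -/
lemma sum_upperLevels {q : ℝ} {n k : ℕ} (hk : k < 2 * n) {x : ℕ → ℕ}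
    (hx : IsPartition ((k + 1 + 1) / 2) x) {v : ℕ → ℤ} (hv : ∀ j, (k + 1) / 2 ≤ j → v j ≤ 0)
    (hv' : ∀ j, n ≤ j → v j = 0) {P : (ℕ → ℕ) → Prop} (hP : ∀ w, P w ↔ toInt w = v)
    {c : (ℕ → ℕ) → ℝ} {c₀ : ℝ}
    (hc : ∀ w, IsPartition ((k + 1) / 2) w → toInt w = v → c w = c₀) :
    ∑ w ∈ upperLevels k x, skewWeight q n (toInt w) (toInt x) * (ind (P w) * c w) =
      skewWeight q n v (toInt x) * c₀ := by
  by_cases hex : ∃ w ∈ upperLevels k x, toInt w = v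
  · obtain ⟨w, hw, rfl⟩ := hex
    rw [Finset.sum_eq_single w]
    · rw [ind_of ((hP w).2 rfl), one_mul, hc w (mem_upperLevels.1 hw).1 rfl]
    · intro u _ hne
      rw [ind_of_not, zero_mul, mul_zero]
      exact fun h => hne (toInt_injective ((hP u).1 h))
    · exact fun h => absurd hw h
  · rw [Finset.sum_eq_zero fun w hw => ?_]
    · suffices h : skewWeight q n v (toInt x) = 0 by rw [h, zero_mul]
      by_contra hne
      have hb : ∀ j, (x (j + 1) : ℤ) ≤ v j ∧ v j ≤ x j := fun j => by
        by_cases hj : j < n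
        · exact bounds_of_skewWeight_ne_zero hne hj
        · rw [hv' j (by omega), hx.zero_of_le (j + 1) (by omega), hx.zero_of_le j (by omega)]
          simp
      have hw : toInt (fun j => (v j).toNat) = v := by
        funext j
        have := (hb j).1
        simp only [toInt]
        omega
      refine hex ⟨fun j => (v j).toNat, mem_upperLevels.2 ⟨⟨?_, fun j hj => ?_⟩, fun j => ?_⟩, hw⟩
      · refine antitone_nat_of_succ_le fun j => ?_
        have h1 := (hb j).1
        have h2 := (hb (j + 1)).2
        omega
      · have := hv j hj
        omega
      · have := hb j
        show (v j).toNat ≤ x j ∧ x (j + 1) ≤ (v j).toNat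
        omega
    · rw [ind_of_not, zero_mul, mul_zero]
      exact fun h => hex ⟨w, hw, (hP w).1 h⟩

/-- The weight of all insertions into patterns with level `x` at position `k` that lead to the
levels before `k` of `Z'` and to the attempt of the move `mv` at level `k`. -/
def arrivalSum (q : ℝ) (n : ℕ) (b : ℕ → ℝ) (Z' : ℕ → ℕ → ℕ) (k : ℕ) (x : ℕ → ℕ) (mv : Move) : ℝ :=
  ∑ Z ∈ patterns k x, pathWeight q n b k Z * arrival q b Z Z' k mv

lemma ind_and (p p' : Prop) : ind (p ∧ p') = ind p * ind p' := by
  by_cases h : p <;> by_cases h' : p' <;> simp [ind, h, h']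

lemma sum_pathWeight_ind (q : ℝ) {n N : ℕ} (b : ℕ → ℝ) (Z' : GTPattern N) {k : ℕ} (hk : k ≤ N)
    {w : ℕ → ℕ} (hw : IsPartition ((k + 1) / 2) w) :
    ∑ Z ∈ patterns k w, pathWeight q n b k Z * ind (∀ j < k + 1, Z'.level j = Z j) =
      ind (Z'.level k = w) * pathWeight q n b k Z'.level := by
  induction k generalizing w with
  | zero =>
    have hw0 : w = 0 := funext fun i => hw.zero_of_le i (Nat.zero_le _)
    have h0 := Z'.outside 0 (Or.inl rfl)
    simp [patterns, pathWeight, hw0, h0]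
  | succ k ih =>
    rw [sum_patterns_succ]
    have h : ∀ v ∈ upperLevels k w, ∑ Z ∈ patterns k v,
        pathWeight q n b (k + 1) (Function.update Z (k + 1) w) *
          ind (∀ j < k + 1 + 1, Z'.level j = Function.update Z (k + 1) w j) =
        ind (Z'.level k = v) * (ind (Z'.level (k + 1) = w) *
          (pathWeight q n b k Z'.level * levelFactor q n (b (k + 1)) v w)) := by
      intro v hv
      have hv' := (mem_upperLevels.1 hv).1
      rw [show ind (Z'.level k = v) * (ind (Z'.level (k + 1) = w) *
          (pathWeight q n b k Z'.level * levelFactor q n (b (k + 1)) v w)) =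
        (ind (Z'.level k = v) * pathWeight q n b k Z'.level) *
          (ind (Z'.level (k + 1) = w) * levelFactor q n (b (k + 1)) v w) by ring,
        ← ih (by omega) hv', Finset.sum_mul]
      refine Finset.sum_congr rfl fun Z hZ => ?_
      rw [pathWeight_succ, pathWeight_update, Function.update_self,
        Function.update_of_ne (by omega), ((mem_patterns hv').1 hZ).2.2.2]
      have hi : ind (∀ j < k + 1 + 1, Z'.level j = Function.update Z (k + 1) w j) =
          ind (∀ j < k + 1, Z'.level j = Z j) * ind (Z'.level (k + 1) = w) := by
        have : (∀ j < k + 1 + 1, Z'.level j = Function.update Z (k + 1) w j) ↔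
            (∀ j < k + 1, Z'.level j = Z j) ∧ Z'.level (k + 1) = w := by
          constructor
          · intro h
            refine ⟨fun j hj => ?_, ?_⟩
            · simpa [Function.update_of_ne (show j ≠ k + 1 by omega)] using h j (by omega)
            · simpa using h (k + 1) (by omega)
          · rintro ⟨h1, h2⟩ j hj
            rcases eq_or_ne j (k + 1) with rfl | hne
            · simpa using h2
            · rw [Function.update_of_ne hne]
              exact h1 j (by omega)
        rw [propext this, ind_and]
      rw [hi]
      ring
    rw [Finset.sum_congr rfl h]
    by_cases hZ : Z'.level (k + 1) = w
    · subst hZ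
      rw [Finset.sum_eq_single (Z'.level k)]
      · rw [ind_of rfl, ind_of rfl, pathWeight_succ]
        ring
      · intro v _ hne
        rw [ind_of_not (Ne.symm hne), zero_mul]
      · intro h
        exact absurd (mem_upperLevels.2
          ⟨Z'.isPartition_level (by omega), Z'.interlaces_level (by omega)⟩) h
    · simp [ind_of_not hZ]

lemma arrivalSum_succ (q : ℝ) (n : ℕ) (b : ℕ → ℝ) (Z' : ℕ → ℕ → ℕ) (k : ℕ) (x : ℕ → ℕ)
    (mv : Move) :
    arrivalSum q n b Z' (k + 1) x mv = ∑ w ∈ upperLevels k x, levelFactor q n (b (k + 1)) w x *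
      ∑ Z ∈ patterns k w, pathWeight q n b k Z *
        arrival q b (Function.update Z (k + 1) x) Z' (k + 1) mv := by
  rw [arrivalSum, sum_patterns_succ]
  refine Finset.sum_congr rfl fun w hw => ?_
  rw [Finset.mul_sum]
  refine Finset.sum_congr rfl fun Z hZ => ?_
  rw [pathWeight_succ, pathWeight_update, Function.update_self, Function.update_of_ne (by omega),
    ((mem_patterns (mem_upperLevels.1 hw).1).1 hZ).2.2.2]
  ring

lemma sum_mul_shift {α : Type*} (s : Finset α) (f : α → ℝ) (F : α → ℕ → ℝ) (i : ℕ) :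
    ∑ Z ∈ s, f Z * shift (F Z) i = shift (fun j => ∑ Z ∈ s, f Z * F Z j) i := by
  cases i <;> simp [shift]

lemma arrivalSum_right (q : ℝ) {n N : ℕ} (b : ℕ → ℝ) (Z' : GTPattern N) {k : ℕ} (hk : k ≤ N)
    (x : ℕ → ℕ) (i : ℕ) :
    arrivalSum q n b Z'.level (k + 1) x (.right i) =
      (if i = 0 then ∑ w ∈ upperLevels k x, levelFactor q n (b (k + 1)) w x *
          (ind (Z'.level k = w) * (b (k + 1) * pathWeight q n b k Z'.level)) else 0) +
      ∑ w ∈ upperLevels k x, levelFactor q n (b (k + 1)) w x *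
        (ind (Z'.level k = w + e i) *
          (r q x w i * arrivalSum q n b Z'.level k w (.right i))) +
      shift (fun j => if k = 2 * j + 1 then 0 else
        ∑ w ∈ upperLevels k x, levelFactor q n (b (k + 1)) w x *
          (ind (Z'.level k = w + e j) *
            ((1 - r q x w j) * arrivalSum q n b Z'.level k w (.right j)))) i := by
  have hmain : ∀ w ∈ upperLevels k x, ∑ Z ∈ patterns k w, pathWeight q n b k Z *
        arrival q b (Function.update Z (k + 1) x) Z'.level (k + 1) (.right i) =
      (if i = 0 then ind (Z'.level k = w) * (b (k + 1) * pathWeight q n b k Z'.level) else 0) +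
      ind (Z'.level k = w + e i) * (r q x w i * arrivalSum q n b Z'.level k w (.right i)) +
      shift (fun j => if k = 2 * j + 1 then 0 else ind (Z'.level k = w + e j) *
        ((1 - r q x w j) * arrivalSum q n b Z'.level k w (.right j))) i := by
    intro w hw
    have hw' := (mem_upperLevels.1 hw).1
    have hstep : ∀ Z ∈ patterns k w, pathWeight q n b k Z *
          arrival q b (Function.update Z (k + 1) x) Z'.level (k + 1) (.right i) =
        (if i = 0 then b (k + 1) * (pathWeight q n b k Z * ind (∀ j < k + 1, Z'.level j = Z j))
          else 0) +
        (ind (Z'.level k = w + e i) * r q x w i) *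
          (pathWeight q n b k Z * arrival q b Z Z'.level k (.right i)) +
        pathWeight q n b k Z * shift (fun j => if k = 2 * j + 1 then 0 else
          (1 - r q x w j) * ind (Z'.level k = w + e j) * arrival q b Z Z'.level k (.right j)) i := by
      intro Z hZ
      have hZk := ((mem_patterns hw').1 hZ).2.2.2
      have hp : (∀ j < k + 1, Z'.level j = Function.update Z (k + 1) x j) ↔
          ∀ j < k + 1, Z'.level j = Z j :=
        forall₂_congr fun j hj => by rw [Function.update_of_ne (by omega)]
      have ha := arrival_congr q b (Y := Function.update Z (k + 1) x) (Z := Z) Z'.level (k := k)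
        (fun j hj => Function.update_of_ne (by omega) _ _)
      simp only [arrival, ha, hp, Function.update_self,
        Function.update_of_ne (show k ≠ k + 1 by omega), hZk]
      split_ifs <;> ring
    rw [Finset.sum_congr rfl hstep, Finset.sum_add_distrib, Finset.sum_add_distrib, sum_mul_shift,
      ← Finset.mul_sum]
    congr 1
    · congr 1
      · split_ifs with h
        · rw [← Finset.mul_sum, sum_pathWeight_ind q b Z' hk hw']
          ring
        · simp
      · rw [arrivalSum]
        ring
    · congr 1
      funext j
      split_ifs with h
      · simp
      · rw [arrivalSum, Finset.mul_sum, Finset.mul_sum]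
        exact Finset.sum_congr rfl fun Z _ => by ring
  rw [arrivalSum_succ, Finset.sum_congr rfl fun w hw => by rw [hmain w hw]]
  simp only [mul_add, Finset.sum_add_distrib, sum_mul_shift, mul_ite, mul_zero]
  congr 1
  · congr 1
    split_ifs <;> simp
  · congr 1
    funext j
    split_ifs <;> simp

lemma arrivalSum_left (q : ℝ) (n : ℕ) (b : ℕ → ℝ) (Z' : ℕ → ℕ → ℕ) (k : ℕ)
    (x : ℕ → ℕ) (i : ℕ) :
    arrivalSum q n b Z' (k + 1) x (.left i) =
      ∑ w ∈ upperLevels k x, levelFactor q n (b (k + 1)) w x *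
        (ind (w = Z' k + e i) * ((1 - l q x w i) * arrivalSum q n b Z' k w (.left i))) +
      (if k = 2 * i + 1 then
        ∑ w ∈ upperLevels k x, levelFactor q n (b (k + 1)) w x *
          (ind (Z' k = w) * ((1 - r q x w i) * arrivalSum q n b Z' k w (.right i))) else 0) +
      shift (fun j => ∑ w ∈ upperLevels k x, levelFactor q n (b (k + 1)) w x *
          (ind (w = Z' k + e j) * (l q x w j * arrivalSum q n b Z' k w (.left j)))) i := by
  have hmain : ∀ w ∈ upperLevels k x, ∑ Z ∈ patterns k w, pathWeight q n b k Z *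
        arrival q b (Function.update Z (k + 1) x) Z' (k + 1) (.left i) =
      ind (w = Z' k + e i) * ((1 - l q x w i) * arrivalSum q n b Z' k w (.left i)) +
      (if k = 2 * i + 1 then
        ind (Z' k = w) * ((1 - r q x w i) * arrivalSum q n b Z' k w (.right i)) else 0) +
      shift (fun j => ind (w = Z' k + e j) *
        (l q x w j * arrivalSum q n b Z' k w (.left j))) i := by
    intro w hw
    have hw' := (mem_upperLevels.1 hw).1
    have hstep : ∀ Z ∈ patterns k w, pathWeight q n b k Z *
          arrival q b (Function.update Z (k + 1) x) Z' (k + 1) (.left i) =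
        (ind (w = Z' k + e i) * (1 - l q x w i)) *
          (pathWeight q n b k Z * arrival q b Z Z' k (.left i)) +
        (if k = 2 * i + 1 then ind (Z' k = w) * (1 - r q x w i) *
          (pathWeight q n b k Z * arrival q b Z Z' k (.right i)) else 0) +
        pathWeight q n b k Z * shift (fun j =>
          l q x w j * ind (w = Z' k + e j) * arrival q b Z Z' k (.left j)) i := by
      intro Z hZ
      have hZk := ((mem_patterns hw').1 hZ).2.2.2
      have ha := arrival_congr q b (Y := Function.update Z (k + 1) x) (Z := Z) Z' (k := k)
        (fun j hj => Function.update_of_ne (by omega) _ _)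
      simp only [arrival, ha, Function.update_self,
        Function.update_of_ne (show k ≠ k + 1 by omega), hZk]
      split_ifs <;> ring
    rw [Finset.sum_congr rfl hstep, Finset.sum_add_distrib, Finset.sum_add_distrib, sum_mul_shift,
      ← Finset.mul_sum]
    congr 1
    · congr 1
      · rw [arrivalSum]
        ring
      · split_ifs with h
        · rw [← Finset.mul_sum, arrivalSum]
          ring
        · simp
    · congr 1
      funext j
      rw [arrivalSum, Finset.mul_sum, Finset.mul_sum]
      exact Finset.sum_congr rfl fun Z _ => by ring
  rw [arrivalSum_succ, Finset.sum_congr rfl fun w hw => by rw [hmain w hw]]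
  simp only [mul_add, Finset.sum_add_distrib, sum_mul_shift, mul_ite, mul_zero]
  congr 2
  split_ifs <;> simp

/-! ### One step of the insertion -/

lemma uPlus_eq_gapAbove (q : ℝ) (x : ℕ → ℕ) (i : ℕ) :
    uPlus q x i = gapAbove q (toInt x) (toInt x) i := by
  cases i <;> rfl

lemma gapAbove_mul_r {q : ℝ} (hq0 : 0 < q) (hq1 : q < 1) (x w : ℕ → ℕ) {i : ℕ}
    (hw : ∀ j, i = j + 1 → w i < w j) :
    gapAbove q (toInt w) (toInt w) i * r q x w i =
      q ^ ((x i : ℤ) - w i) * gapAbove q (toInt w) (toInt x) i := by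
  cases i with
  | zero => simp [gapAbove, r]
  | succ i =>
    have h := one_sub_zpow_ne_zero hq0 hq1 (m := (w i : ℤ) - w (i + 1))
      (by have := hw i rfl; omega)
    simp only [gapAbove, r, toInt]
    rw [mul_left_comm, mul_div_cancel₀ _ h]

lemma gapAbove_mul_one_sub_r {q : ℝ} (hq0 : 0 < q) (hq1 : q < 1) (x w : ℕ → ℕ) {i : ℕ}
    (hw : ∀ j, i = j + 1 → w i < w j) :
    gapAbove q (toInt w) (toInt w) i * (1 - r q x w i) = 1 - q ^ ((x i : ℤ) - w i) := by
  rw [mul_sub, gapAbove_mul_r hq0 hq1 x w hw]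
  cases i with
  | zero => simp [gapAbove]
  | succ i =>
    have h : q ^ ((x (i + 1) : ℤ) - w (i + 1)) * q ^ ((w i : ℤ) - x (i + 1)) =
        q ^ ((w i : ℤ) - w (i + 1)) := by
      rw [← zpow_add₀ hq0.ne']; congr 1; ring
    simp only [gapAbove, toInt]
    rw [mul_sub, h]
    ring

lemma uMinus_mul_l {q : ℝ} (hq0 : 0 < q) (hq1 : q < 1) (x w : ℕ → ℕ) {i : ℕ}
    (hw : w (i + 1) < w i) :
    uMinus q w i * l q x w i =
      q ^ ((w i : ℤ) - x (i + 1)) * (1 - q ^ ((x (i + 1) : ℤ) - w (i + 1))) := by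
  have h := one_sub_zpow_ne_zero hq0 hq1 (m := (w i : ℤ) - w (i + 1)) (by omega)
  rw [uMinus, l, mul_left_comm, mul_div_cancel₀ _ h]

lemma uMinus_mul_one_sub_l {q : ℝ} (hq0 : 0 < q) (hq1 : q < 1) (x w : ℕ → ℕ) {i : ℕ}
    (hw : w (i + 1) < w i) :
    uMinus q w i * (1 - l q x w i) = 1 - q ^ ((w i : ℤ) - x (i + 1)) := by
  have h : q ^ ((w i : ℤ) - x (i + 1)) * q ^ ((x (i + 1) : ℤ) - w (i + 1)) =
      q ^ ((w i : ℤ) - w (i + 1)) := by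
    rw [← zpow_add₀ hq0.ne']; congr 1; ring
  rw [mul_sub, uMinus_mul_l hq0 hq1 x w hw, mul_sub, h, uMinus]
  ring

lemma lt_of_antitone_add_e {w : ℕ → ℕ} {i : ℕ} (h : Antitone (w + e i)) (j : ℕ)
    (hij : i = j + 1) : w i < w j := by
  subst hij
  have := h (Nat.le_succ j)
  simp only [e, Nat.succ_eq_add_one, Pi.add_apply, Pi.single_eq_same] at this
  rw [Pi.single_eq_of_ne (by omega)] at this
  omega

lemma add_e_lt {w : ℕ → ℕ} (h : Antitone w) (i : ℕ) : (w + e i) (i + 1) < (w + e i) i := by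
  have := h (Nat.le_succ i)
  simpa [e, Nat.lt_succ_iff] using this

section Step

variable {q : ℝ} {n k : ℕ} {c : ℝ} {x w' : ℕ → ℕ}

lemma levelFactor_sum_eq (F : (ℕ → ℕ) → ℝ) (P : (ℕ → ℕ) → Prop) :
    ∑ w ∈ upperLevels k x, levelFactor q n c w x * (ind (P w) * F w) =
      ∑ w ∈ upperLevels k x, skewWeight q n (toInt w) (toInt x) *
        (ind (P w) * (c ^ (size n x - size n w) * F w)) :=
  Finset.sum_congr rfl fun w _ => by rw [levelFactor]; ring

/-- The level above does not move. -/
lemma sum_stay (hk : k < 2 * n) (hx : IsPartition ((k + 1 + 1) / 2) x)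
    (hw' : IsPartition ((k + 1) / 2) w') (F : (ℕ → ℕ) → ℝ) :
    ∑ w ∈ upperLevels k x, levelFactor q n c w x * (ind (w' = w) * F w) =
      c ^ (size n x - size n w') * skewWeight q n (toInt w') (toInt x) * F w' := by
  rw [levelFactor_sum_eq, sum_upperLevels hk hx (v := toInt w')
    (c₀ := c ^ (size n x - size n w') * F w') (P := fun w => w' = w)
    (c := fun w => c ^ (size n x - size n w) * F w)]
  · ring
  · intro j hj
    simp [toInt, hw'.zero_of_le j hj]
  · intro j hj
    simp [toInt, hw'.zero_of_le j (by omega)]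
  · exact fun w => ⟨fun h => by rw [h], fun h => (toInt_injective h).symm⟩
  · intro w _ h
    rw [toInt_injective h]

/-- The level above moves to the right at position `i`. -/
lemma sum_moveRight (hk : k < 2 * n) (hx : IsPartition ((k + 1 + 1) / 2) x)
    (hw' : IsPartition ((k + 1) / 2) w') {i : ℕ} (hi : i < n) {F : (ℕ → ℕ) → ℝ} {F₀ : ℝ}
    (hF : ∀ w, IsPartition ((k + 1) / 2) w → w' = w + e i → F w = F₀) :
    ∑ w ∈ upperLevels k x, levelFactor q n c w x * (ind (w' = w + e i) * F w) =
      c ^ (size n x + 1 - size n w') * skewWeight q n (toInt w' - unitAt i) (toInt x) * F₀ := by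
  have hiff : ∀ w, w' = w + e i ↔ toInt w = toInt w' - unitAt i := fun w => by
    rw [eq_sub_iff_add_eq, ← toInt_add_e]
    exact ⟨fun h => by rw [h], fun h => (toInt_injective h).symm⟩
  rw [levelFactor_sum_eq, sum_upperLevels hk hx (v := toInt w' - unitAt i)
    (c₀ := c ^ (size n x + 1 - size n w') * F₀) _ _ hiff]
  · ring
  · intro w hw h
    have h' := (hiff w).2 h
    rw [hF w hw h', h', size_add_e hi]
    congr 2
    ring
  · intro j hj
    have : 0 ≤ unitAt i j := by
      by_cases h : j = i
      · subst h; simp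
      · simp [unitAt_of_ne h]
    simp [toInt, hw'.zero_of_le j hj, this]
  · intro j hj
    simp [toInt, hw'.zero_of_le j (by omega), unitAt_of_ne (show j ≠ i by omega)]

/-- The level above moves to the left at position `i`. -/
lemma sum_moveLeft (hk : k < 2 * n) (hx : IsPartition ((k + 1 + 1) / 2) x)
    (hw' : IsPartition ((k + 1) / 2) w') {i : ℕ} (hi : i < (k + 1) / 2) {F : (ℕ → ℕ) → ℝ}
    {F₀ : ℝ} (hF : ∀ w, IsPartition ((k + 1) / 2) w → w = w' + e i → F w = F₀) :
    ∑ w ∈ upperLevels k x, levelFactor q n c w x * (ind (w = w' + e i) * F w) =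
      c ^ (size n x - 1 - size n w') * skewWeight q n (toInt w' + unitAt i) (toInt x) * F₀ := by
  have hiff : ∀ w, w = w' + e i ↔ toInt w = toInt w' + unitAt i := fun w => by
    rw [← toInt_add_e]
    exact ⟨fun h => by rw [h], fun h => toInt_injective h⟩
  rw [levelFactor_sum_eq, sum_upperLevels hk hx (v := toInt w' + unitAt i)
    (c₀ := c ^ (size n x - 1 - size n w') * F₀) _ _ hiff]
  · ring
  · intro w hw h
    have h' := (hiff w).2 h
    rw [hF w hw h', h', size_add_e (by omega)]
    congr 2
    ring
  · intro j hj
    simp [toInt, hw'.zero_of_le j hj, unitAt_of_ne (show j ≠ i by omega)]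
  · intro j hj
    simp [toInt, hw'.zero_of_le j (by omega), unitAt_of_ne (show j ≠ i by omega)]

/-- A right move at position `i` that pushes position `i` of the next level. -/
lemma sum_right_same (hq0 : 0 < q) (hq1 : q < 1) (hk : k < 2 * n)
    (hx : IsPartition ((k + 1 + 1) / 2) x)
    (hw' : IsPartition ((k + 1) / 2) w') {i : ℕ} (hi : i < n) {S : (ℕ → ℕ) → ℝ} {V : ℝ}
    (hS : ∀ w, IsPartition ((k + 1) / 2) w → w' = w + e i → S w = uPlus q w i * V) :
    ∑ w ∈ upperLevels k x, levelFactor q n c w x * (ind (w' = w + e i) * (r q x w i * S w)) =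
      c ^ (size n x + 1 - size n w') * (gapAbove q (toInt w') (toInt x) i *
        (q ^ ((x i : ℤ) - w' i + 1) * skewWeight q n (toInt w' - unitAt i) (toInt x))) * V := by
  rw [sum_moveRight hk hx hw' hi
    (F₀ := gapAbove q (toInt w') (toInt x) i * q ^ ((x i : ℤ) - w' i + 1) * V)]
  · ring
  · intro w hw h
    have hlt := lt_of_antitone_add_e (h ▸ hw'.anti)
    have h1 : gapAbove q (toInt w) (toInt x) i = gapAbove q (toInt w') (toInt x) i := by
      cases i with
      | zero => rfl
      | succ j => simp [gapAbove, toInt, h, e]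
    have h2 : (x i : ℤ) - w i = (x i : ℤ) - w' i + 1 := by
      simp only [h, e, Pi.add_apply, Pi.single_eq_same]
      push_cast
      ring
    rw [hS w hw h, uPlus_eq_gapAbove, ← mul_assoc, mul_comm (r q x w i),
      gapAbove_mul_r hq0 hq1 x w hlt, h1, h2]
    ring

/-- A right move at position `i` that pushes position `i + 1` of the next level. -/
lemma sum_right_next (hq0 : 0 < q) (hq1 : q < 1) (hk : k < 2 * n)
    (hx : IsPartition ((k + 1 + 1) / 2) x)
    (hw' : IsPartition ((k + 1) / 2) w') {i : ℕ} (hi : i < n) {S : (ℕ → ℕ) → ℝ} {V : ℝ}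
    (hS : ∀ w, IsPartition ((k + 1) / 2) w → w' = w + e i → S w = uPlus q w i * V) :
    ∑ w ∈ upperLevels k x,
        levelFactor q n c w x * (ind (w' = w + e i) * ((1 - r q x w i) * S w)) =
      c ^ (size n x + 1 - size n w') * (gapAbove q (toInt w') (toInt x) (i + 1) *
        skewWeight q n (toInt w') (toInt x)) * V := by
  rw [sum_moveRight hk hx hw' hi (F₀ := (1 - q ^ ((x i : ℤ) - w' i + 1)) * V)]
  · have := skewWeight_sub_unitAt hq0 hq1 hi (toInt w') (toInt x)
    simp only [gapAbove]
    rw [← this]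
    simp only [toInt]
    ring
  · intro w hw h
    have hlt := lt_of_antitone_add_e (h ▸ hw'.anti)
    have h2 : (x i : ℤ) - w i = (x i : ℤ) - w' i + 1 := by
      simp only [h, e, Pi.add_apply, Pi.single_eq_same]
      push_cast
      ring
    rw [hS w hw h, uPlus_eq_gapAbove, ← mul_assoc, mul_comm (1 - r q x w i),
      gapAbove_mul_one_sub_r hq0 hq1 x w hlt, h2]

/-- A left move at position `i` that pulls position `i` of the next level. -/
lemma sum_left_same (hq0 : 0 < q) (hq1 : q < 1) (hk : k < 2 * n)
    (hx : IsPartition ((k + 1 + 1) / 2) x)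
    (hw' : IsPartition ((k + 1) / 2) w') {i : ℕ} (hi : i < (k + 1) / 2) {S : (ℕ → ℕ) → ℝ} {V : ℝ}
    (hS : ∀ w, IsPartition ((k + 1) / 2) w → w = w' + e i → S w = uMinus q w i * V) :
    ∑ w ∈ upperLevels k x,
        levelFactor q n c w x * (ind (w = w' + e i) * ((1 - l q x w i) * S w)) =
      c ^ (size n x - 1 - size n w') * ((1 - q ^ ((x i : ℤ) - w' i)) *
        skewWeight q n (toInt w') (toInt x)) * V := by
  rw [sum_moveLeft hk hx hw' hi (F₀ := (1 - q ^ ((w' i : ℤ) + 1 - x (i + 1))) * V)]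
  · have := skewWeight_add_unitAt hq0 hq1 (show i < n by omega) (toInt w') (toInt x)
    simp only [toInt] at this ⊢
    rw [← this]
    ring
  · intro w hw h
    have hlt : w (i + 1) < w i := h ▸ add_e_lt hw'.anti i
    have h2 : (w i : ℤ) = w' i + 1 := by simp [h, e]
    rw [hS w hw h, ← mul_assoc, mul_comm (1 - l q x w i), uMinus_mul_one_sub_l hq0 hq1 x w hlt, h2]

/-- A left move at position `i` that pulls position `i + 1` of the next level. -/
lemma sum_left_next (hq0 : 0 < q) (hq1 : q < 1) (hk : k < 2 * n)
    (hx : IsPartition ((k + 1 + 1) / 2) x)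
    (hw' : IsPartition ((k + 1) / 2) w') {i : ℕ} (hi : i < (k + 1) / 2) {S : (ℕ → ℕ) → ℝ} {V : ℝ}
    (hS : ∀ w, IsPartition ((k + 1) / 2) w → w = w' + e i → S w = uMinus q w i * V) :
    ∑ w ∈ upperLevels k x,
        levelFactor q n c w x * (ind (w = w' + e i) * (l q x w i * S w)) =
      c ^ (size n x - 1 - size n w') * ((1 - q ^ ((x (i + 1) : ℤ) - w' (i + 1))) *
        pushLeft q n (toInt w') (toInt x) (i + 1)) * V := by
  rw [sum_moveLeft hk hx hw' hi (F₀ := q ^ ((w' i : ℤ) + 1 - x (i + 1)) *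
    (1 - q ^ ((x (i + 1) : ℤ) - w' (i + 1))) * V)]
  · simp only [pushLeft, toInt]
    ring
  · intro w hw h
    have h1 : w (i + 1) = w' (i + 1) := by simp [h, e]
    have hlt : w (i + 1) < w i := h ▸ add_e_lt hw'.anti i
    have h2 : (w i : ℤ) = w' i + 1 := by simp [h, e]
    rw [hS w hw h, ← mul_assoc, mul_comm (l q x w i), uMinus_mul_l hq0 hq1 x w hlt, h2, h1]

end Step

section Induction

variable {q : ℝ} {n : ℕ} {b : ℕ → ℝ} (Z' : GTPattern (2 * n))

lemma skewWeight_sub_unitAt_eq_zero {w x : ℕ → ℕ} {i : ℕ} (hi : i < n) (hw : w i = 0) :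
    skewWeight q n (toInt w - unitAt i) (toInt x) = 0 := by
  by_contra h
  have := (bounds_of_skewWeight_ne_zero h hi).1
  simp only [toInt, Pi.sub_apply, unitAt_self, hw] at this
  omega

/-- Attempts of right jumps at level `k + 1`, given those at level `k`. -/
lemma arrivalSum_succ_right (hq0 : 0 < q) (hq1 : q < 1) (hb : ∀ k, 0 < b k) {k : ℕ}
    (hk : k < 2 * n)
    (hR : ∀ w, IsPartition ((k + 1) / 2) w → ∀ i, Z'.level k = w + e i →
      arrivalSum q n b Z'.level k w (.right i) = uPlus q w i * pathWeight q n b k Z'.level)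
    {x : ℕ → ℕ} (hx : IsPartition ((k + 1 + 1) / 2) x) {i : ℕ} (hi : i < (k + 1 + 1) / 2) :
    arrivalSum q n b Z'.level (k + 1) x (.right i) =
      b (k + 1) ^ (size n x + 1 - size n (Z'.level k)) *
        (gapAbove q (toInt (Z'.level k)) (toInt x) i *
          (skewWeight q n (toInt (Z'.level k)) (toInt x) + q ^ ((x i : ℤ) - Z'.level k i + 1) *
            skewWeight q n (toInt (Z'.level k) - unitAt i) (toInt x))) *
        pathWeight q n b k Z'.level := by
  have hw' := Z'.isPartition_level hk.le
  rw [arrivalSum_right q b Z' hk.le,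
    sum_right_same hq0 hq1 hk hx hw' (show i < n by omega) (fun w hw h => hR w hw i h)]
  cases i with
  | zero =>
    rw [if_pos rfl, sum_stay hk hx hw', shift, add_sub_right_comm, zpow_add_one₀ (hb _).ne']
    simp only [gapAbove]
    ring
  | succ i =>
    rw [if_neg (by omega), shift, if_neg (by omega),
      sum_right_next hq0 hq1 hk hx hw' (by omega) (fun w hw h => hR w hw i h)]
    ring

/-- Left jumps at level `k + 1`, given those at level `k`. If `k = 2 i + 1`, the contribution of a
left jump of the last particle of level `k` is smaller than in the other cases, and the suppressed
right jumps make up for it. -/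
lemma arrivalSum_succ_left (hq0 : 0 < q) (hq1 : q < 1) {k : ℕ} (hk : k < 2 * n)
    (hL : ∀ w, IsPartition ((k + 1) / 2) w → ∀ i, k ≠ 2 * i + 1 → w = Z'.level k + e i →
      arrivalSum q n b Z'.level k w (.left i) = uMinus q w i * pathWeight q n b k Z'.level)
    {x : ℕ → ℕ} (hx : IsPartition ((k + 1 + 1) / 2) x) {D : ℕ → ℝ}
    (hLast : ∀ i, k = 2 * i + 1 →
      (∀ w, IsPartition ((k + 1) / 2) w → w = Z'.level k + e i →
        arrivalSum q n b Z'.level k w (.left i) =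
          uMinus q w i * (pathWeight q n b k Z'.level - D i)) ∧
      b (k + 1) ^ (size n x - size n (Z'.level k)) *
          skewWeight q n (toInt (Z'.level k)) (toInt x) *
          ((1 - r q x (Z'.level k) i) *
            arrivalSum q n b Z'.level k (Z'.level k) (.right i)) =
        b (k + 1) ^ (size n x - 1 - size n (Z'.level k)) *
          ((1 - q ^ ((x i : ℤ) - Z'.level k i)) *
            skewWeight q n (toInt (Z'.level k)) (toInt x)) * D i)
    {i : ℕ} (hi : i < (k + 1 + 1) / 2) :
    arrivalSum q n b Z'.level (k + 1) x (.left i) =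
      b (k + 1) ^ (size n x - 1 - size n (Z'.level k)) *
        ((1 - q ^ ((x i : ℤ) - Z'.level k i)) *
          ((if k = 2 * i then 0 else skewWeight q n (toInt (Z'.level k)) (toInt x)) +
            pushLeft q n (toInt (Z'.level k)) (toInt x) i)) *
        pathWeight q n b k Z'.level := by
  have hw' := Z'.isPartition_level hk.le
  rw [arrivalSum_left]
  have hshift : shift (fun j => ∑ w ∈ upperLevels k x, levelFactor q n (b (k + 1)) w x *
        (ind (w = Z'.level k + e j) *
          (l q x w j * arrivalSum q n b Z'.level k w (.left j)))) i =
      b (k + 1) ^ (size n x - 1 - size n (Z'.level k)) *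
        ((1 - q ^ ((x i : ℤ) - Z'.level k i)) *
          pushLeft q n (toInt (Z'.level k)) (toInt x) i) * pathWeight q n b k Z'.level := by
    cases i with
    | zero => simp [shift, pushLeft]
    | succ i =>
      rw [shift, sum_left_next hq0 hq1 hk hx hw' (by omega)
        (fun w hw h => hL w hw i (by omega) h)]
  have hmain : ∑ w ∈ upperLevels k x, levelFactor q n (b (k + 1)) w x *
        (ind (w = Z'.level k + e i) *
          ((1 - l q x w i) * arrivalSum q n b Z'.level k w (.left i))) +
      (if k = 2 * i + 1 then
        ∑ w ∈ upperLevels k x, levelFactor q n (b (k + 1)) w x *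
          (ind (Z'.level k = w) *
            ((1 - r q x w i) * arrivalSum q n b Z'.level k w (.right i))) else 0) =
      b (k + 1) ^ (size n x - 1 - size n (Z'.level k)) *
        ((1 - q ^ ((x i : ℤ) - Z'.level k i)) *
          (if k = 2 * i then 0 else skewWeight q n (toInt (Z'.level k)) (toInt x))) *
        pathWeight q n b k Z'.level := by
    by_cases hik : k = 2 * i
    · rw [if_neg (by omega), if_pos hik, Finset.sum_eq_zero]
      · simp
      · intro w hw
        have hwp := (mem_upperLevels.1 hw).1
        rw [ind_of_not, zero_mul, mul_zero]
        intro h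
        have h0 := hwp.zero_of_le i (by omega)
        rw [h] at h0
        simp [e] at h0
    · rw [if_neg hik]
      by_cases hik' : k = 2 * i + 1
      · rw [if_pos hik', sum_left_same hq0 hq1 hk hx hw' (by omega) (hLast i hik').1,
          sum_stay hk hx hw', (hLast i hik').2]
        ring
      · rw [if_neg hik', sum_left_same hq0 hq1 hk hx hw' (by omega)
          (fun w hw h => hL w hw i hik' h)]
        ring
  rw [hshift, hmain]
  ring

/-- The suppressed right jumps of the last particle of level `2 i + 1`, which become left jumps at
the next level. -/
lemma suppressed_right (hq0 : 0 < q) (hq1 : q < 1) (hb : ∀ k, 0 < b k) {i : ℕ} (hi : i < n)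
    (hb' : b (2 * i + 1 + 1) = (b (2 * i + 1))⁻¹) (x : ℕ → ℕ) {A : ℝ}
    (hA : A = b (2 * i + 1) * gapAbove q (toInt (Z'.level (2 * i))) (toInt (Z'.level (2 * i + 1))) i
      * pathWeight q n b (2 * i + 1) Z'.level) :
    b (2 * i + 1 + 1) ^ (size n x - size n (Z'.level (2 * i + 1))) *
        skewWeight q n (toInt (Z'.level (2 * i + 1))) (toInt x) *
        ((1 - r q x (Z'.level (2 * i + 1)) i) * A) =
      b (2 * i + 1 + 1) ^ (size n x - 1 - size n (Z'.level (2 * i + 1))) *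
        ((1 - q ^ ((x i : ℤ) - Z'.level (2 * i + 1) i)) *
          skewWeight q n (toInt (Z'.level (2 * i + 1))) (toInt x)) *
        (b (2 * i + 1) ^ (size n (Z'.level (2 * i + 1)) - size n (Z'.level (2 * i))) *
          skewWeight q n (toInt (Z'.level (2 * i))) (toInt (Z'.level (2 * i + 1)) + unitAt i) *
          pathWeight q n b (2 * i) Z'.level) := by
  have hw := Z'.isPartition_level (show 2 * i + 1 ≤ 2 * n by omega)
  have hv := Z'.isPartition_level (show 2 * i ≤ 2 * n by omega)
  have hint := Z'.interlaces_level (show 2 * i < 2 * n by omega)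
  have key : (1 - r q x (Z'.level (2 * i + 1)) i) *
      (gapAbove q (toInt (Z'.level (2 * i))) (toInt (Z'.level (2 * i + 1))) i *
        skewWeight q n (toInt (Z'.level (2 * i))) (toInt (Z'.level (2 * i + 1)))) =
      (1 - q ^ ((x i : ℤ) - Z'.level (2 * i + 1) i)) *
        skewWeight q n (toInt (Z'.level (2 * i))) (toInt (Z'.level (2 * i + 1)) + unitAt i) := by
    by_cases hlt : ∀ j, i = j + 1 → Z'.level (2 * i + 1) i < Z'.level (2 * i + 1) j
    · have h := skewWeight_right hq0 hq1 hi (toInt (Z'.level (2 * i)))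
        (toInt (Z'.level (2 * i + 1))) (Int.ofNat_le.2 (hw.anti (Nat.le_succ i)))
        (fun j hj => Int.ofNat_lt.2 (hlt j hj))
      rw [skewWeight_sub_unitAt_eq_zero hi (hv.zero_of_le i (by omega)), mul_zero, add_zero] at h
      rw [h, ← gapAbove_mul_one_sub_r hq0 hq1 x _ hlt]
      ring
    · -- The last two particles of the level coincide: the last one cannot move to the right.
      push Not at hlt
      obtain ⟨j, rfl, hj⟩ := hlt
      have h1 := hw.anti (Nat.le_succ j)
      have h2 := hint j
      have h0 : gapAbove q (toInt (Z'.level (2 * (j + 1))))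
          (toInt (Z'.level (2 * (j + 1) + 1))) (j + 1) = 0 := by
        simp only [gapAbove, toInt, Nat.succ_eq_add_one] at *
        rw [show (Z'.level (2 * (j + 1)) j : ℤ) - Z'.level (2 * (j + 1) + 1) (j + 1) = 0 by omega]
        simp
      have h3 : skewWeight q n (toInt (Z'.level (2 * (j + 1))))
          (toInt (Z'.level (2 * (j + 1) + 1)) + unitAt (j + 1)) = 0 := by
        by_contra hne
        have := (bounds_of_skewWeight_ne_zero hne (show j < n by omega)).1
        simp only [toInt, Pi.add_apply, unitAt_self] at this
        omega
      rw [h0, h3]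
      ring
  have hpow : b (2 * i + 1 + 1) ^ (size n x - size n (Z'.level (2 * i + 1))) * b (2 * i + 1) =
      b (2 * i + 1 + 1) ^ (size n x - 1 - size n (Z'.level (2 * i + 1))) := by
    rw [hb', show size n x - size n (Z'.level (2 * i + 1)) =
      size n x - 1 - size n (Z'.level (2 * i + 1)) + 1 by ring,
      zpow_add_one₀ (inv_ne_zero (hb _).ne'), mul_assoc, inv_mul_cancel₀ (hb _).ne', mul_one]
  rw [hA, pathWeight_succ, levelFactor, ← hpow]
  linear_combination (b (2 * i + 1 + 1) ^ (size n x - size n (Z'.level (2 * i + 1))) *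
    b (2 * i + 1) * skewWeight q n (toInt (Z'.level (2 * i + 1))) (toInt x) *
    pathWeight q n b (2 * i) Z'.level *
    b (2 * i + 1) ^ (size n (Z'.level (2 * i + 1)) - size n (Z'.level (2 * i)))) * key

/-- The intertwining at every level. A jump at level `k` that completes `Z'` arrives with the rate
of the `q`-Pieri operator times the weight of `Z'`, except that for the last particle of an odd
level the rate of a right jump is given where the jump is about to be suppressed, and the rate of a
left jump is reduced. -/
lemma arrivalSum_eq (hq0 : 0 < q) (hq1 : q < 1) (hb : ∀ k, 0 < b k)
    (hb' : ∀ i, b (2 * i + 1 + 1) = (b (2 * i + 1))⁻¹) {k : ℕ} (hk : k ≤ 2 * n) :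
    (∀ x, IsPartition ((k + 1) / 2) x → ∀ i, Z'.level k = x + e i →
      arrivalSum q n b Z'.level k x (.right i) = uPlus q x i * pathWeight q n b k Z'.level) ∧
    (∀ x, IsPartition ((k + 1) / 2) x → ∀ i, k ≠ 2 * i + 1 → x = Z'.level k + e i →
      arrivalSum q n b Z'.level k x (.left i) = uMinus q x i * pathWeight q n b k Z'.level) ∧
    (∀ i, k = 2 * i + 1 → arrivalSum q n b Z'.level k (Z'.level k) (.right i) =
      b k * gapAbove q (toInt (Z'.level (k - 1))) (toInt (Z'.level k)) i *
        pathWeight q n b k Z'.level) ∧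
    (∀ x, IsPartition ((k + 1) / 2) x → ∀ i, k = 2 * i + 1 → x = Z'.level k + e i →
      arrivalSum q n b Z'.level k x (.left i) = uMinus q x i * (pathWeight q n b k Z'.level -
        b k ^ (size n (Z'.level k) - size n (Z'.level (k - 1))) *
          skewWeight q n (toInt (Z'.level (k - 1))) (toInt (Z'.level k) + unitAt i) *
          pathWeight q n b (k - 1) Z'.level)) := by
  induction k with
  | zero =>
    have h0 := Z'.outside 0 (Or.inl rfl)
    refine ⟨fun x _ i h => ?_, fun x hx i _ h => ?_, fun i h => by omega,
      fun x _ i h => by omega⟩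
    · have := congrFun h i
      simp [h0, e] at this
    · have := congrFun h i
      simp [h0, e, hx.zero_of_le i (Nat.zero_le _)] at this
  | succ k ih =>
    obtain ⟨hR, hL, hRl, hLl⟩ := ih (by omega)
    have hk' : k < 2 * n := by omega
    have hZ := Z'.isPartition_level hk
    have hZk := Z'.isPartition_level hk'.le
    have right : ∀ {x}, IsPartition ((k + 1 + 1) / 2) x → ∀ {i}, i < (k + 1 + 1) / 2 → _ :=
      fun {x} hx {i} hi => arrivalSum_succ_right Z' hq0 hq1 hb hk' hR hx hi
    have left : ∀ {x}, IsPartition ((k + 1 + 1) / 2) x → ∀ {i}, i < (k + 1 + 1) / 2 → _ :=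
      fun {x} hx {i} hi => arrivalSum_succ_left Z' hq0 hq1 hk' hL hx
        (D := fun i => b k ^ (size n (Z'.level k) - size n (Z'.level (k - 1))) *
          skewWeight q n (toInt (Z'.level (k - 1))) (toInt (Z'.level k) + unitAt i) *
          pathWeight q n b (k - 1) Z'.level)
        (fun i hki => ⟨fun w hw h => hLl w hw i hki h, by
          subst hki
          exact suppressed_right Z' hq0 hq1 hb (by omega) (hb' i) x (hRl i rfl)⟩) hi
    refine ⟨fun x hx i h => ?_, fun x hx i hki h => ?_, fun i hki => ?_, fun x hx i hki h => ?_⟩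
    · have hi : i < (k + 1 + 1) / 2 := by
        by_contra! hi
        have := hZ.zero_of_le i hi
        simp [h, e] at this
      have hs := skewWeight_right hq0 hq1 (show i < n by omega) (toInt (Z'.level k)) (toInt x)
        (Int.ofNat_le.2 (hx.anti (Nat.le_succ i)))
        (fun j hj => Int.ofNat_lt.2 (lt_of_antitone_add_e (h ▸ hZ.anti) j hj))
      rw [right hx hi, uPlus_eq_gapAbove, pathWeight_succ, levelFactor, h, toInt_add_e,
        size_add_e (show i < n by omega)]
      simp only [toInt] at hs ⊢
      rw [hs]
      ring
    · have hi : i < (k + 1 + 1) / 2 := by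
        by_contra! hi
        have := hx.zero_of_le i hi
        simp [h, e] at this
      have hs := skewWeight_left hq0 hq1 (show i < n by omega) (toInt (Z'.level k)) (toInt x)
        (Int.ofNat_lt.2 (h ▸ add_e_lt hZ.anti i))
        (fun j hj => Int.ofNat_le.2 (hx.anti (by omega)))
      have hx' : toInt x - unitAt i = toInt (Z'.level (k + 1)) := by
        rw [h, toInt_add_e, add_sub_cancel_right]
      have hsz : size n x - 1 = size n (Z'.level (k + 1)) := by
        rw [h, size_add_e (show i < n by omega), add_sub_cancel_right]
      rw [hx'] at hs
      rw [left hx hi, if_neg (by omega), hsz, pathWeight_succ, levelFactor, uMinus]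
      simp only [toInt] at hs ⊢
      rw [hs]
      ring
    · have h0 := skewWeight_sub_unitAt_eq_zero (q := q) (x := Z'.level (k + 1))
        (show i < n by omega) (hZk.zero_of_le i (by omega))
      rw [right hZ (by omega), h0, mul_zero, add_zero, pathWeight_succ, levelFactor,
        add_sub_right_comm, zpow_add_one₀ (hb _).ne', Nat.add_sub_cancel]
      ring
    · have hs := skewWeight_left hq0 hq1 (show i < n by omega) (toInt (Z'.level k)) (toInt x)
        (Int.ofNat_lt.2 (h ▸ add_e_lt hZ.anti i))
        (fun j hj => Int.ofNat_le.2 (hx.anti (by omega)))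
      have hx' : toInt x - unitAt i = toInt (Z'.level (k + 1)) := by
        rw [h, toInt_add_e, add_sub_cancel_right]
      have hx'' : toInt (Z'.level (k + 1)) + unitAt i = toInt x := by rw [h, toInt_add_e]
      have hsz : size n x - 1 = size n (Z'.level (k + 1)) := by
        rw [h, size_add_e (show i < n by omega), add_sub_cancel_right]
      rw [hx'] at hs
      rw [left hx (by omega), if_pos (by omega), hsz, pathWeight_succ, levelFactor, uMinus,
        Nat.add_sub_cancel, hx'']
      have h1 : Z'.level k i = 0 := hZk.zero_of_le i (by omega)
      have h2 : x (i + 1) = 0 := hx.zero_of_le (i + 1) (by omega)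
      simp only [toInt, h1, h2] at hs ⊢
      linear_combination (b (k + 1) ^ (size n (Z'.level (k + 1)) - size n (Z'.level k)) *
        pathWeight q n b k Z'.level) * hs

end Induction

/-! ### The kernel as a product over levels -/

lemma weight_eq_size {n : ℕ} (Z : GTPattern (2 * n)) {k : ℕ} (hk : k ≤ 2 * n) :
    (Z.weight k : ℤ) = size n (Z.level k) := by
  rw [GTPattern.weight, size, Nat.cast_sum]
  refine Finset.sum_subset (Finset.range_subset_range.2 (by omega)) fun j _ hj => ?_
  rw [(Z.isPartition_level hk).zero_of_le j (by simpa using hj), Nat.cast_zero]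

/-- The weight of two neighbouring levels is a product of `q`-binomial coefficients over the
particles that are not at the wall. -/
lemma skewWeight_eq_prod_qBinom {q : ℝ} (hq0 : 0 < q) (hq1 : q < 1) {n m : ℕ} (hm : m ≤ n)
    {w x : ℕ → ℕ} (hx : Antitone x) (h : Interlaces w x)
    (h0 : ∀ j, m ≤ j → w j = 0 ∧ x (j + 1) = 0) :
    skewWeight q n (toInt w) (toInt x) =
      ∏ j ∈ Finset.range m, qBinom q (x j - x (j + 1)) (x j - w j) := by
  rw [skewWeight, ← Finset.prod_subset (Finset.range_subset_range.2 hm)]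
  · refine Finset.prod_congr rfl fun j _ => ?_
    have h1 := h j
    have h2 := hx (Nat.le_succ j)
    rw [qBinom_eq hq1 (by omega), skewFactor]
    simp only [toInt]
    congr 2
    · congr 1
      omega
    · congr 1
      omega
    · omega
  · intro j _ hj
    obtain ⟨h1, h2⟩ := h0 j (by simpa using hj)
    have hp : pochInv q 0 = 1 := by simp [pochInv, qPoch]
    simp only [skewFactor, toInt, h1, h2]
    rw [Nat.cast_zero, sub_zero, sub_zero, hp, mul_one, poch_mul_pochInv hq0 hq1 (by omega)]

lemma prod_range_two_mul {A : Type*} [CommMonoid A] (f : ℕ → A) (n : ℕ) :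
    ∏ j ∈ Finset.range (2 * n), f j = ∏ i ∈ Finset.range n, (f (2 * i) * f (2 * i + 1)) := by
  induction n with
  | zero => simp
  | succ n ih =>
    rw [Finset.prod_range_succ, ← ih, Nat.mul_succ, Finset.prod_range_succ,
      Finset.prod_range_succ, mul_assoc]

lemma aPow_mul_kappa {q : ℝ} (hq0 : 0 < q) (hq1 : q < 1) {n : ℕ} {a : Fin n → ℝ}
    (ha : ∀ i, 0 < a i) (Z : GTPattern (2 * n)) :
    aPow a Z * kappa q Z = pathWeight q n (orderWeight a) (2 * n) Z.level := by
  rw [aPow, kappa, pathWeight, prod_range_two_mul, Finset.prod_range (n := n),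
    Finset.prod_range (n := n), ← Finset.prod_mul_distrib]
  refine Finset.prod_congr rfl fun i _ => ?_
  have hi := i.2
  have h1 := Z.isPartition_level (show 2 * (i : ℕ) + 1 ≤ 2 * n by omega)
  have h2 := Z.isPartition_level (show 2 * (i : ℕ) + 2 ≤ 2 * n by omega)
  have h3 := Z.isPartition_level (show 2 * (i : ℕ) ≤ 2 * n by omega)
  rw [levelFactor, levelFactor, show 2 * (i : ℕ) + 1 + 1 = 2 * i + 2 from rfl, orderWeight_odd,
    orderWeight_even, inv_zpow', skewWeight_eq_prod_qBinom hq0 hq1 (m := i) (by omega) h1.anti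
      (Z.interlaces_level (by omega)) (fun j hj =>
        ⟨h3.zero_of_le j (by omega), h1.zero_of_le (j + 1) (by omega)⟩),
    skewWeight_eq_prod_qBinom hq0 hq1 (m := i + 1) (by omega) h2.anti
      (Z.interlaces_level (show 2 * (i : ℕ) + 1 < 2 * n by omega)) (fun j hj =>
        ⟨h1.zero_of_le j (by omega), h2.zero_of_le (j + 1) (by omega)⟩),
    Finset.prod_range_succ, Finset.prod_mul_distrib, h2.zero_of_le (i + 1) (by omega), Nat.sub_zero,
    weight_eq_size Z (by omega), weight_eq_size Z (by omega), weight_eq_size Z (by omega)]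
  rw [show 2 * size n (Z.level (2 * i + 1)) - size n (Z.level (2 * i + 2)) -
      size n (Z.level (2 * i)) = (size n (Z.level (2 * i + 1)) - size n (Z.level (2 * i))) +
      -(size n (Z.level (2 * i + 2)) - size n (Z.level (2 * i + 1))) by ring,
    zpow_add₀ (ha i).ne']
  ring

/-! ### The intertwining relation -/

lemma isPartition_last {n : ℕ} (Z : GTPattern (2 * n)) : IsPartition n (Z.level (2 * n)) := by
  have h := Z.isPartition_level le_rfl
  rwa [show (2 * n + 1) / 2 = n by omega] at h

lemma comp_K_M {q : ℝ} (hq0 : 0 < q) (hq1 : q < 1) {n : ℕ} {a : Fin n → ℝ} (ha : ∀ i, 0 < a i)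
    (lam : Part n) (Z' : GTPattern (2 * n)) :
    comp (K q a) (M q a) lam Z' = ∑ i ∈ Finset.range (2 * n + 1),
      (arrivalSum q n (orderWeight a) Z'.level (2 * n) lam.1 (.right i) *
          ind (Z'.level (2 * n) = lam.1 + e i) +
        arrivalSum q n (orderWeight a) Z'.level (2 * n) lam.1 (.left i) *
          ind (lam.1 = Z'.level (2 * n) + e i)) := by
  have hlam : IsPartition ((2 * n + 1) / 2) lam.1 := by
    rw [show (2 * n + 1) / 2 = n by omega]
    exact lam.2
  have h := tsum_ind_level hlam (fun Z =>
    ∑ i ∈ Finset.range (2 * n + 1), pathWeight q n (orderWeight a) (2 * n) Z *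
      (arrival q (orderWeight a) Z Z'.level (2 * n) (.right i) *
          ind (Z'.level (2 * n) = Z (2 * n) + e i) +
        arrival q (orderWeight a) Z Z'.level (2 * n) (.left i) *
          ind (Z (2 * n) = Z'.level (2 * n) + e i)))
  rw [comp]
  refine (tsum_congr fun Z => ?_).trans (h.trans ?_)
  · rw [K, aPow_mul_kappa hq0 hq1 ha, M_eq_sum_arrival, ← Finset.mul_sum]
    ring
  · rw [Finset.sum_comm]
    refine Finset.sum_congr rfl fun i _ => ?_
    rw [arrivalSum, arrivalSum, Finset.sum_mul, Finset.sum_mul, ← Finset.sum_add_distrib]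
    refine Finset.sum_congr rfl fun Z hZ => ?_
    rw [((mem_patterns hlam).1 hZ).2.2.2]
    ring

lemma comp_L_K {q : ℝ} (hq0 : 0 < q) (hq1 : q < 1) {n : ℕ} {a : Fin n → ℝ} (ha : ∀ i, 0 < a i)
    (lam : Part n) (Z' : GTPattern (2 * n)) :
    comp (L q) (K q a) lam Z' = ∑ i ∈ Finset.range n,
      (uPlus q lam.1 i * ind (Z'.level (2 * n) = lam.1 + e i) +
        uMinus q lam.1 i * ind (lam.1 = Z'.level (2 * n) + e i)) *
      pathWeight q n (orderWeight a) (2 * n) Z'.level := by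
  obtain ⟨mu, hmu⟩ : ∃ mu : Part n, mu.1 = Z'.level (2 * n) := ⟨⟨_, isPartition_last Z'⟩, rfl⟩
  rw [comp, tsum_eq_single mu]
  · rw [K, aPow_mul_kappa hq0 hq1 ha, ind_of hmu.symm, mul_one, L, hmu, Finset.sum_mul]
  · intro nu hne
    rw [K, ind_of_not fun h => hne (Subtype.ext (h.symm.trans hmu.symm)), mul_zero, mul_zero]

lemma comp_K_M_eq_comp_L_K {q : ℝ} (hq0 : 0 < q) (hq1 : q < 1) {n : ℕ} {a : Fin n → ℝ}
    (ha : ∀ i, 0 < a i) : comp (K q a) (M q a) = comp (L q) (K q a) := by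
  funext lam Z'
  have hlam : IsPartition ((2 * n + 1) / 2) lam.1 := by
    rw [show (2 * n + 1) / 2 = n by omega]
    exact lam.2
  obtain ⟨hR, hL, -⟩ := arrivalSum_eq Z' hq0 hq1 (orderWeight_pos ha) (orderWeight_succ a) le_rfl
  -- A particle with index `i ≥ n` does not exist, so these terms of the left side vanish.
  rw [comp_K_M hq0 hq1 ha, comp_L_K hq0 hq1 ha,
    ← Finset.sum_subset (Finset.range_subset_range.2 (show n ≤ 2 * n + 1 by omega))]
  · refine Finset.sum_congr rfl fun i _ => ?_
    rw [add_mul]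
    congr 1
    · by_cases h : Z'.level (2 * n) = lam.1 + e i
      · rw [ind_of h, hR _ hlam i h]
        ring
      · simp only [ind_of_not h, mul_zero, zero_mul]
    · by_cases h : lam.1 = Z'.level (2 * n) + e i
      · rw [ind_of h, hL _ hlam i (by omega) h]
        ring
      · simp only [ind_of_not h, mul_zero, zero_mul]
  · intro i _ hi
    have hi' : n ≤ i := by simpa using hi
    rw [ind_of_not, ind_of_not, mul_zero, mul_zero, add_zero]
    · intro h
      have := lam.2.zero_of_le i hi'
      simp [h, e] at this
    · intro h
      have := (isPartition_last Z').zero_of_le i hi'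
      simp [h, e] at this

lemma finite_support_K_mul_M (q : ℝ) {n : ℕ} (a : Fin n → ℝ) (lam : Part n)
    (Z' : GTPattern (2 * n)) : (Function.support fun Z => K q a lam Z * M q a Z Z').Finite := by
  refine (finite_level_eq lam.1).subset fun Z hZ => ?_
  by_contra hne
  refine hZ ?_
  change aPow a Z * kappa q Z * ind (Z.level (2 * n) = lam.1) * M q a Z Z' = 0
  rw [ind_of_not (p := Z.level (2 * n) = lam.1) hne, mul_zero, zero_mul]

lemma finite_support_L_mul_K (q : ℝ) {n : ℕ} (a : Fin n → ℝ) (lam : Part n)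
    (Z' : GTPattern (2 * n)) : (Function.support fun mu => L q lam mu * K q a mu Z').Finite := by
  refine Set.Subsingleton.finite fun mu hmu nu hnu => ?_
  have h : ∀ mu : Part n, L q lam mu * K q a mu Z' ≠ 0 → Z'.level (2 * n) = mu.1 := fun mu hmu => by
    by_contra hne
    exact hmu (by rw [K, ind_of_not hne, mul_zero, mul_zero])
  exact Subtype.ext ((h mu hmu).symm.trans (h nu hnu))

end

end QBerele

theorem theorem6p1 (n : ℕ) (hn : 1 ≤ n) (q : ℝ) (hq0 : 0 < q) (hq1 : q < 1)
    (a : Fin n → ℝ) (ha : ∀ i, 0 < a i) :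
    (∀ (lam : QBerele.Part n) (Z' : QBerele.GTPattern (2 * n)),
      (Function.support (fun Z : QBerele.GTPattern (2 * n) =>
        QBerele.K q a lam Z * QBerele.M q a Z Z')).Finite) ∧
    (∀ (lam : QBerele.Part n) (Z' : QBerele.GTPattern (2 * n)),
      (Function.support (fun mu : QBerele.Part n =>
        QBerele.L q lam mu * QBerele.K q a mu Z')).Finite) ∧
    QBerele.comp (QBerele.K q a) (QBerele.M q a) = QBerele.comp (QBerele.L q) (QBerele.K q a) :=
  ⟨QBerele.finite_support_K_mul_M q a, QBerele.finite_support_L_mul_K q a,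
    QBerele.comp_K_M_eq_comp_L_K hq0 hq1 ha⟩
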